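/- **Setting.** Let $G_D$ be a connected plane graph (loops and parallel edges allowed, at least one edge) with $n$ vertices, all of degree at most three; it is the dual of a planar flow network whose terminals $s,t$ are two different faces of $G_D$. Let $r\ge 1$. A *holeless $r$-partition* with constants $c_1,c_2$ is a partition of the edges of $G_D$ into at most $c_1 n/r$ nonempty clusters, such that every cluster has at most $r$ vertices and at most $c_2\sqrt r$ *border vertices* (vertices of the cluster that also have an edge in another cluster), and such that all border vertices of a cluster lie on one face of the cluster, its hole, which contains all edges of the other clusters at these vertices. The *skeleton graph* has, for every cluster with more than one border vertex, an edge between any two cyclically consecutive border vertices on its hole, drawn in the hole along the boundary of the cluster. Let $f_s,f_t$ be vertices of $G_D$ on the faces $s,t$, let $P_s\ni f_s$ and $P_t\ni f_t$ be clusters, and suppose that the faces $s,t$ are visible in the graph $\overline G^{s,t}$ formed by $P_s$, $P_t$, the skeleton graph, and the dense distance graph (the complete graph on the border vertices) of every other cluster. The *contracted graph* $\overline G^{s,t}_c$ is the plane graph obtained from $\overline G^{s,t}$ by replacing the dense distance graph of every cluster $P\ne P_s,P_t$ with more than one border vertex by a star with a new centre $v_P$. Let $\pi=(f_1,\dots,f_k)$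 consist of a simple path in $P_s$ from $f_s$ to a border vertex $b_s$ of $P_s$, a simple path in the skeleton graph from $b_s$ to a border vertex $b_t$ of $P_t$, and a simple path in $P_t$ from $b_t$ to $f_t$. **Recursion.** The first call has the graph $\overline G^{s,t}_c$ and the path $\pi$. A call with a graph $H$ and a part $f_a,\dots,f_b$ of the path first removes vertices of degree two from $H$, by merging their two edges, as long as possible (a single vertex with a loop is left alone). Then it either ends, or it chooses an index $a\le i\le b$ and an $f_i$-cut-cycle $C$, splits $H$ along $C$, and makes two recursive calls: one on $H\cap \mathrm{int}(C)$ with $f_a,\dots,f_{i-1}$, and one on $H\cap\mathrm{ext}(C)$ with $f_{i+1},\dots,f_b$. Here an $f_i$-cut-cycle is a closed walk in $H$ which passes through $f_i$ and through no $f_j$ with $j>i$, separates $s$ from $t$, visits every vertex other than a star centre at most once, passes through star centres without crossing itself, and does not turn back along an edge except possibly at $f_i$ (so that, except at $f_i$, it does not use two consecutive edges of the same dense distance graph). The interior is the side of $s$, and $C$ belongs to both sides; a star is divided by the passages of $C$ through its centre into one star for every group of border vertices that $C$ does not separate. In $H\cap\mathrm{int}(C)$ the missing exterior is one face that replaces $t$,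 and in $H\cap\mathrm{ext}(C)$ the missing interior is one face that replaces $s$. **Claim.** For all $c_1,c_2$ there is a constant $C$, depending on $c_1$ and $c_2$ only, such that for all these data, for every recursion tree (that is, for every choice of indices and cut-cycles, in particular for middle indices and minimum cut-cycles) and for every level of it, the total number of vertices of the contracted graphs at this level, after the removal of the vertices of degree two and with the star centres counted, is at most $C\,\bigl(r+\frac{n}{\sqrt r}\bigr)$. -/

import Mathlib

open Classical in
/-- `nextSame f c d` is the first of `f d, f (f d), …` on which the colour `c` has the same
value as on `d`. -/
noncomputable def nextSameFun {D K : Type*} [Finite D] (f : Equiv.Perm D) (c : D → K) (d : D) : D :=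
  if h : ∃ k : ℕ, c (f^[k + 1] d) = c d then f^[Nat.find h + 1] d else d

theorem nextSame_exists {D K : Type*} [Finite D] (f : Equiv.Perm D) (c : D → K) (d : D) :
    ∃ k : ℕ, c (f^[k + 1] d) = c d := by
  obtain ⟨n, hn, h⟩ := (isOfFinOrder_of_finite f).exists_pow_eq_one
  refine ⟨n - 1, ?_⟩
  have : n - 1 + 1 = n := Nat.succ_pred_eq_of_pos hn
  rw [this, Equiv.Perm.iterate_eq_pow, h]
  rfl

open Classical in
theorem nextSameFun_spec {D K : Type*} [Finite D] (f : Equiv.Perm D) (c : D → K) (d : D) :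
    ∃ k : ℕ, nextSameFun f c d = f^[k + 1] d ∧ c (f^[k + 1] d) = c d ∧
      ∀ j < k, c (f^[j + 1] d) ≠ c d := by
  have h := nextSame_exists f c d
  refine ⟨Nat.find h, ?_, Nat.find_spec h, fun j hj => Nat.find_min h hj⟩
  simp only [nextSameFun, dif_pos h]

theorem nextSameFun_injective {D K : Type*} [Finite D] (f : Equiv.Perm D) (c : D → K) :
    Function.Injective (nextSameFun f c) := by
  have key : ∀ (d e : D) (k l : ℕ), k ≤ l → f^[k + 1] d = f^[l + 1] e →
      c (f^[k + 1] d) = c d → c (f^[l + 1] e) = c e →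
      (∀ j < l, c (f^[j + 1] e) ≠ c e) → d = e := by
    intro d e k l hkl h hd he hmin
    have h1 : f^[k + 1] d = f^[k + 1] (f^[l - k] e) := by
      have hkl' : k + 1 + (l - k) = l + 1 := by omega
      rw [← Function.iterate_add_apply, h, hkl']
    have h2 : d = f^[l - k] e := f.injective.iterate (k + 1) h1
    rcases Nat.eq_or_lt_of_le hkl with hk | hk
    · simpa [hk] using h2
    · exfalso
      apply hmin (l - k - 1) (by omega)
      have : l - k - 1 + 1 = l - k := by omega
      rw [this, ← h2, ← hd, h, he]
  intro d e h
  obtain ⟨k, hk, hkc, hkm⟩ := nextSameFun_spec f c d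
  obtain ⟨l, hl, hlc, hlm⟩ := nextSameFun_spec f c e
  have h' : f^[k + 1] d = f^[l + 1] e := by rw [← hk, ← hl, h]
  rcases le_total k l with hkl | hkl
  · exact key d e k l hkl h' hkc hlc hlm
  · exact (key e d l k hkl h'.symm hlc hkc hkm).symm

/-- The first-return permutation of `f` on every colour class of `c`. -/
noncomputable def nextSame {D K : Type*} [Finite D] (f : Equiv.Perm D) (c : D → K) :
    Equiv.Perm D :=
  Equiv.ofBijective (nextSameFun f c)
    (Finite.injective_iff_bijective.mp (nextSameFun_injective f c))

/-- The face permutation of a rotation system: `σ` turns counterclockwise around the vertices and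
`α` reverses the darts. The dart `d` stands for the corner between `d` and `σ d`, which lies to the
left of `d`; the orbits are the faces. -/
def facePerm {D : Type*} (σ α : Equiv.Perm D) : Equiv.Perm D := σ⁻¹ * α

/-- A connected graph (loops and parallel edges allowed, at least one edge) embedded in the plane,
given by its rotation system on the set `D` of darts (directed edges). -/
structure PlaneGraph (V D : Type*) [Fintype V] [Fintype D] where
  /-- counterclockwise rotation of the darts around their origin -/
  σ : Equiv.Perm D
  /-- reversal of darts -/
  α : Equiv.Perm D
  /-- origin of a dart -/
  vtx : D → V
  α_invol : ∀ d, α (α d) = d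
  α_ne : ∀ d, α d ≠ d
  vtx_surj : Function.Surjective vtx
  vtx_eq_iff : ∀ d e, vtx d = vtx e ↔ σ.SameCycle d e
  connected : ∀ d e : D, e ∈ MulAction.orbit (Subgroup.closure ({σ, α} : Set (Equiv.Perm D))) d
  /-- Euler's formula `V - E + F = 2`, with `E` half the number of darts -/
  euler : 2 * (Fintype.card V +
      Set.ncard (Set.range fun d : D => {e | (facePerm σ α).SameCycle d e})) =
    Fintype.card D + 4

namespace PlaneGraph

variable {V D K : Type*} [Fintype V] [Fintype D]

/-- The orbits of `G.face` are the faces of `G`, that is, the vertices of the primal graph. -/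
def face (G : PlaneGraph V D) : Equiv.Perm D := facePerm G.σ G.α

/-- `v` is a vertex of the cluster `p`, for the partition of the edges given by `cl`. -/
def InCluster (G : PlaneGraph V D) (cl : D → K) (p : K) (v : V) : Prop :=
  ∃ d, G.vtx d = v ∧ cl d = p

/-- `v` is a border vertex of the cluster `p`: it also has an edge in another cluster. -/
def IsBorder (G : PlaneGraph V D) (cl : D → K) (p : K) (v : V) : Prop :=
  G.InCluster cl p v ∧ ∃ q, q ≠ p ∧ G.InCluster cl q v

/-- The corner after the dart `d` leaves the cluster of `d`. -/
def Exit (G : PlaneGraph V D) (cl : D → K) (d : D) : Prop := cl (G.σ d) ≠ cl d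

/-- The face permutation of the clusters, each one embedded as a plane graph of its own. -/
noncomputable def clusterFace (G : PlaneGraph V D) (cl : D → K) : Equiv.Perm D :=
  facePerm (nextSame G.σ cl) G.α

/-- An `r`-partition of the `n`-vertex plane graph `G` into the edge clusters `cl⁻¹ {p}`, `p : K`,
with the constants `c₁`, `c₂` in the bounds on the number of clusters and on the number of border
vertices, in which every cluster has one hole: all border vertices of a cluster lie, with
all their corners that contain edges of other clusters, on one face of the cluster. -/
structure IsHolelessRPartition [Fintype K] (G : PlaneGraph V D) (cl : D → K) (r : ℕ)
    (c₁ c₂ : ℝ) : Prop where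
  edge : ∀ d, cl (G.α d) = cl d
  nonempty : Function.Surjective cl
  card_clusters : (Fintype.card K : ℝ) ≤ c₁ * ((Fintype.card V : ℝ) / r)
  card_vertices : ∀ p, Set.ncard {v | G.InCluster cl p v} ≤ r
  card_border : ∀ p, (Set.ncard {v | G.IsBorder cl p v} : ℝ) ≤ c₂ * √(r : ℝ)
  one_hole : ∀ d e, G.Exit cl d → G.Exit cl e → cl d = cl e →
    (G.clusterFace cl).SameCycle d e

/-- If the corner after `d` leaves the cluster `p` of `d`, then `nextExit cl d` is the same kind of
corner at the border vertex of `p` that follows on the hole of `p` (going clockwise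
around the cluster). -/
noncomputable def nextExit (G : PlaneGraph V D) (cl : D → K) : Equiv.Perm D :=
  nextSame (G.clusterFace cl) (G.Exit cl)

/-- The corner (named by the dart before it) through which the boundary walk that leaves the exit
corner of `d` enters the vertex of `nextExit cl d`. -/
noncomputable def arrive (G : PlaneGraph V D) (cl : D → K) : Equiv.Perm D :=
  (nextSame G.σ (G.Exit cl))⁻¹ * G.nextExit cl

/-- `d` is an exit corner of a cluster with more than one border vertex. -/
def Proper (G : PlaneGraph V D) (cl : D → K) (d : D) : Prop :=
  G.Exit cl d ∧ G.nextExit cl d ≠ d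

end PlaneGraph

/-- A plane graph whose darts are the elements of the finite set `darts` (the values of the
permutations elsewhere are irrelevant). `vtx d` is the name of the origin of `d`; it is `none` if
the origin is a star centre that replaces a dense distance graph. -/
structure PlaneMap (A V : Type*) where
  darts : Finset A
  σ : Equiv.Perm A
  α : Equiv.Perm A
  vtx : A → Option V

namespace PlaneGraph

variable {V D K : Type*} [Fintype V] [Fintype D]

/-- Which of the candidates `(d, k)` are darts of the contracted graph with explicit clusters
`ps` and `pt`:
`(d, 0)` is `d` itself if its cluster is explicit, otherwise the star edge, directed to the
star centre, of the border vertex whose exit corner is after `d`;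
`(d, 1)` and `(d, 2)` are, in the exit corner after `d`, the outgoing skeleton dart of the cluster
of `d` and the incoming skeleton dart of the cluster of `σ d`;
`(d, 3)` is the star edge directed away from the star centre. -/
def Active (G : PlaneGraph V D) (cl : D → K) (ps pt : K) : D × Fin 4 → Prop
  | (d, 0) => (cl d = ps ∨ cl d = pt) ∨ G.Proper cl d
  | (d, 1) => G.Proper cl d
  | (d, 2) => G.Proper cl ((G.arrive cl)⁻¹ d)
  | (d, 3) => ¬ (cl d = ps ∨ cl d = pt) ∧ G.Proper cl d

/-- The counterclockwise order of all candidates around the vertices and the star centres. -/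
noncomputable def fullRotation (G : PlaneGraph V D) (cl : D → K) : Equiv.Perm (D × Fin 4) where
  toFun x := match x with
    | (d, 0) => (d, 1)
    | (d, 1) => (d, 2)
    | (d, 2) => (G.σ d, 0)
    | (d, 3) => ((G.nextExit cl)⁻¹ d, 3)
  invFun x := match x with
    | (d, 0) => (G.σ⁻¹ d, 2)
    | (d, 1) => (d, 0)
    | (d, 2) => (d, 1)
    | (d, 3) => (G.nextExit cl d, 3)
  left_inv := by rintro ⟨d, k⟩; fin_cases k <;> simp
  right_inv := by rintro ⟨d, k⟩; fin_cases k <;> simp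

open Classical in
/-- Reversal of the candidates. A skeleton edge joins the exit corner of `d` with the corner in
which the boundary walk arrives at the next border vertex of the hole. -/
noncomputable def reverseFun (G : PlaneGraph V D) (cl : D → K) (ps pt : K) (x : D × Fin 4) :
    D × Fin 4 :=
  match x with
  | (d, 0) => if cl d = ps ∨ cl d = pt then (G.α d, 0) else (d, 3)
  | (d, 1) => (G.arrive cl d, 2)
  | (d, 2) => ((G.arrive cl)⁻¹ d, 1)
  | (d, 3) => if cl d = ps ∨ cl d = pt then (d, 3) else (d, 0)

theorem reverseFun_involutive (G : PlaneGraph V D) (cl : D → K) (ps pt : K)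
    (hcl : ∀ d, cl (G.α d) = cl d) : Function.Involutive (G.reverseFun cl ps pt) := by
  rintro ⟨d, k⟩
  fin_cases k
  · by_cases h : cl d = ps ∨ cl d = pt
    · simp [reverseFun, h, hcl, G.α_invol]
    · simp [reverseFun, h]
  · simp [reverseFun]
  · simp [reverseFun]
  · by_cases h : cl d = ps ∨ cl d = pt <;> simp [reverseFun, h]

open Classical in
/-- The contracted graph at the root of the recursion: the clusters `ps` and `pt`, the skeleton
edges joining consecutive border vertices on the hole of every cluster, and, for
every other cluster with more than one border vertex, a star on its border vertices with a new
centre. It is a plane graph, with the embedding inherited from `G`. The second summand `ℕ` of the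
type of darts is a supply of new names. -/
noncomputable def contracted (G : PlaneGraph V D) (cl : D → K) (hcl : ∀ d, cl (G.α d) = cl d)
    (ps pt : K) : PlaneMap ((D × Fin 4) ⊕ ℕ) V where
  darts := (Finset.univ.filter (G.Active cl ps pt)).map Function.Embedding.inl
  σ := Equiv.sumCongr (nextSame (G.fullRotation cl) (G.Active cl ps pt)) (Equiv.refl ℕ)
  α := Equiv.sumCongr (G.reverseFun_involutive cl ps pt hcl).toPerm (Equiv.refl ℕ)
  vtx x := match x with
    | Sum.inl (_, 3) => none
    | Sum.inl (d, _) => some (G.vtx d)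
    | Sum.inr _ => none

/-- `x` is a corner of the contracted graph that lies in the face of `d₀` of `G`. -/
def IsCornerInFace (G : PlaneGraph V D) (cl : D → K) (ps pt : K) (d₀ : D) (x : (D × Fin 4) ⊕ ℕ) :
    Prop :=
  ∃ d k, x = Sum.inl (d, k) ∧ G.Active cl ps pt (d, k) ∧ G.face.SameCycle d₀ d ∧
    (k = 1 ∨ (k = 0 ∧ (cl d = ps ∨ cl d = pt)) ∨
      (k = 2 ∧ (cl (G.σ d) = ps ∨ cl (G.σ d) = pt)))

/-- `p` is a simple path from `u` to `v` for the adjacency relation `adj`. -/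
def IsSimplePath {V : Type*} (adj : V → V → Prop) (u v : V) (p : List V) : Prop :=
  p.head? = some u ∧ p.getLast? = some v ∧ p.Nodup ∧ p.IsChain adj

/-- Adjacency in the cluster `p`. -/
def ClusterAdj (G : PlaneGraph V D) (cl : D → K) (p : K) (u v : V) : Prop :=
  ∃ d, cl d = p ∧ G.vtx d = u ∧ G.vtx (G.α d) = v

/-- Adjacency in the skeleton graph. -/
def SkeletonAdj (G : PlaneGraph V D) (cl : D → K) (u v : V) : Prop :=
  ∃ d, G.Proper cl d ∧ ((G.vtx d = u ∧ G.vtx (G.nextExit cl d) = v) ∨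
    (G.vtx d = v ∧ G.vtx (G.nextExit cl d) = u))

/-- `π` consists of a simple path from `fs` to a border vertex `bs` in the cluster `ps`, a simple
path from `bs` to a border vertex `bt` of `pt` in the skeleton graph, and a simple path from `bt` to
`ft` in `pt`. -/
def IsDividingPath (G : PlaneGraph V D) (cl : D → K) (ps pt : K) (fs ft : V) (π : List V) : Prop :=
  G.InCluster cl ps fs ∧ G.InCluster cl pt ft ∧
  ∃ bs bt p₁ p₂ p₃, G.IsBorder cl ps bs ∧ G.IsBorder cl pt bt ∧
    IsSimplePath (G.ClusterAdj cl ps) fs bs p₁ ∧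
    IsSimplePath (G.SkeletonAdj cl) bs bt p₂ ∧
    IsSimplePath (G.ClusterAdj cl pt) bt ft p₃ ∧
    π = p₁ ++ p₂.tail ++ p₃.tail

end PlaneGraph

namespace PlaneMap

variable {A V : Type*} [DecidableEq A]

/-- The number of vertices (including star centres): the number of orbits of the rotation. -/
noncomputable def numVertices (M : PlaneMap A V) : ℕ :=
  Set.ncard ((fun d => {e | M.σ.SameCycle d e}) '' (M.darts : Set A))

/-- `x` is an unused name. -/
def Fresh (M : PlaneMap A V) (x : A) : Prop := x ∉ M.darts ∧ M.σ x = x ∧ M.α x = x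

/-- Double the edge with the darts `a` and `b = α a`: it is replaced by the parallel edges
`{a, b'}`, on the left of `a`, and `{a', b}`, on the right, with a new face (with the two
corners `a'` and `b'`) between them. -/
def double (M : PlaneMap A V) (a a' b' : A) : PlaneMap A V where
  darts := insert a' (insert b' M.darts)
  σ := Equiv.swap (M.α a) b' * Equiv.swap a a' * M.σ
  α := Equiv.swap (M.α a) b' * Equiv.swap a a' * M.α * Equiv.swap a' b'
  vtx := Function.update (Function.update M.vtx a' (M.vtx a)) b' (M.vtx (M.α a))

/-- Split the vertex with the corners `x` and `y` into two, by a cut from the corner `x` to the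
corner `y`. -/
def splitAt (M : PlaneMap A V) (x y : A) : PlaneMap A V :=
  { M with σ := M.σ * Equiv.swap x y }

/-- The darts in the connected component of `d`. -/
noncomputable def component (M : PlaneMap A V) (d : A) : Finset A := by
  classical
  exact M.darts.filter
    (fun e => e ∈ MulAction.orbit (Subgroup.closure ({M.σ, M.α} : Set (Equiv.Perm A))) d)

/-- The connected component of `d` as a plane graph of its own. -/
noncomputable def restrict (M : PlaneMap A V) (d : A) : PlaneMap A V :=
  { M with darts := M.component d }

/-- Cutting the plane graph `M` open along a walk that starts at the vertex `v`:
`Slit M v M' a₀ b b' S` says that `M'` arises from `M` by cutting along the edges of such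
a walk and through the vertices passed so far. Each traversed edge is doubled; each vertex
that is passed is split into its part to the left and its part to the right of the walk. The walk
has arrived with the dart `b` (directed backwards) at a vertex which, like the
starting vertex `v`, is not yet split; `b'` and `a₀` are the corners from which
the cut enters these two vertices. `S` is the set of vertices met so far; none of them is
entered again. A star centre may be passed repeatedly, since the walk may use several edges of the
same dense distance graph, but the cuts through it do not cross. After the start the walk never
turns back along the edge by which it has come, so that it does not use two consecutive edges of
one dense distance graph. -/
inductive Slit (M : PlaneMap A V) (v : V) : PlaneMap A V → A → A → A → Set V → Prop
  | start (a a' b' : A) (ha : a ∈ M.darts) (hv : M.vtx a = some v) (hne : a' ≠ b')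
      (ha' : M.Fresh a') (hb' : M.Fresh b') :
      Slit M v (M.double a a' b') a' (M.α a) b' {v}
  | step (N : PlaneMap A V) (a₀ b b' : A) (S : Set V) (h : Slit M v N a₀ b b' S)
      (hS : ∀ w ∈ S, N.vtx b ≠ some w) (a a₁ b₁ : A) (ha : a ∈ N.darts)
      (hab : N.σ.SameCycle b a) (hb : a ≠ b) (hb' : a ≠ b') (hne : a₁ ≠ b₁)
      (ha₁ : N.Fresh a₁) (hb₁ : N.Fresh b₁) :
      Slit M v ((N.double a a₁ b₁).splitAt b' a₁) a₀ (N.α a) b₁ (S ∪ {w | N.vtx b = some w})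

end PlaneMap

/-- A graph in the recursion: a plane graph with the corners `s` and `t`, whose faces
are those in which the two terminals lie. -/
structure RecNode (A V : Type*) where
  M : PlaneMap A V
  s : A
  t : A

namespace RecNode

variable {A V : Type*} [DecidableEq A]

/-- The dart `a` starts at a vertex of degree two that is not the only vertex of its component, so
that its two edges can be merged. -/
def DegreeTwo (M : PlaneMap A V) (a : A) : Prop :=
  a ∈ M.darts ∧ M.σ a ≠ a ∧ M.σ (M.σ a) = a ∧ M.α a ≠ M.σ a

/-- Remove the origin of `a`, a vertex of degree two, by merging its two edges. -/
def merge (M : PlaneMap A V) (a : A) : PlaneMap A V where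
  darts := (M.darts.erase a).erase (M.σ a)
  σ := M.σ * Equiv.swap a (M.σ a)
  α := M.α * Equiv.swap a (M.α a) * Equiv.swap (M.σ a) (M.α (M.σ a)) *
    Equiv.swap (M.α a) (M.α (M.σ a))
  vtx := M.vtx

/-- One step of the removal of the vertices of degree two; the first two kinds of steps name
the faces of `s` and `t` by other corners. -/
inductive ReduceStep : RecNode A V → RecNode A V → Prop
  | moveS (M : PlaneMap A V) (s s' t : A) (h : (facePerm M.σ M.α).SameCycle s s') :
      ReduceStep ⟨M, s, t⟩ ⟨M, s', t⟩
  | moveT (M : PlaneMap A V) (s t t' : A) (h : (facePerm M.σ M.α).SameCycle t t') :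
      ReduceStep ⟨M, s, t⟩ ⟨M, s, t'⟩
  | merge (M : PlaneMap A V) (s t a : A) (ha : DegreeTwo M a) (hs : s ∈ (merge M a).darts)
      (ht : t ∈ (merge M a).darts) :
      ReduceStep ⟨M, s, t⟩ ⟨RecNode.merge M a, s, t⟩

/-- `N'` arises from `N` by removing vertices of degree two as long as there are any. -/
def Reduces (N N' : RecNode A V) : Prop :=
  Relation.ReflTransGen ReduceStep N N' ∧ ∀ a, ¬ DegreeTwo N'.M a

/-- `Nint` and `Next` are the parts of `N` in the interior and in the exterior of an `f_i`-cut-cycle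
`C`, where `f_i = π[i]`: `C` passes through `π[i]`, not through any later vertex of `π`, and it
separates the faces `s` and `t`. Cutting along `C` gives two graphs, one with `s`, the interior, and
one with `t`, the exterior; in either of them the missing side of `C` is now one face, which takes
the role of the missing terminal. -/
def IsSplit (π : List V) (i : ℕ) (N Nint Next : RecNode A V) : Prop :=
  ∃ (v : V) (M' M'' : PlaneMap A V) (a₀ b b' hs ht : A) (S : Set V),
    π[i]? = some v ∧ PlaneMap.Slit N.M v M' a₀ b b' S ∧ M'.vtx b = some v ∧
    (∀ j, i < j → ∀ w, π[j]? = some w → w ∉ S) ∧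
    M'' = M'.splitAt b' a₀ ∧
    N.t ∉ M''.component N.s ∧
    ((hs = a₀ ∧ ht = b') ∨ (hs = b' ∧ ht = a₀)) ∧
    hs ∈ M''.component N.s ∧ ht ∈ M''.component N.t ∧
    Nint = ⟨M''.restrict N.s, N.s, hs⟩ ∧ Next = ⟨M''.restrict N.t, ht, N.t⟩

end RecNode

/-- A recursion tree of the divide-and-conquer algorithm on `π`, for the subgraph `N` and the part
`π[lo], …, π[hi - 1]` of the path. A call first removes the vertices of degree two from its graph;
then it either ends or splits the graph along some `f_i`-cut-cycle with `lo ≤ i < hi` and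
recurses on the interior with the vertices of `π` before `π[i]`, and on the exterior with those after
`π[i]`. -/
inductive RecursionTree {A V : Type*} [DecidableEq A] (π : List V) :
    RecNode A V → ℕ → ℕ → Type _
  | halt {N : RecNode A V} {lo hi : ℕ} (N' : RecNode A V) (h : N.Reduces N') :
      RecursionTree π N lo hi
  | recurse {N : RecNode A V} {lo hi : ℕ} (N' Nint Next : RecNode A V) (i : ℕ)
      (h : N.Reduces N') (hlo : lo ≤ i) (hhi : i < hi)
      (hsplit : RecNode.IsSplit π i N' Nint Next)
      (Tint : RecursionTree π Nint lo i) (Text : RecursionTree π Next (i + 1) hi) :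
      RecursionTree π N lo hi

/-- The total number of vertices of the (reduced) contracted graphs at a level of the tree. -/
noncomputable def RecursionTree.levelVertices {A V : Type*} [DecidableEq A] {π : List V} :
    {N : RecNode A V} → {lo hi : ℕ} → RecursionTree π N lo hi → ℕ → ℕ
  | _, _, _, .halt N' _, 0 => N'.M.numVertices
  | _, _, _, .halt _ _, _ + 1 => 0
  | _, _, _, .recurse N' _ _ _ _ _ _ _ _ _, 0 => N'.M.numVertices
  | _, _, _, .recurse _ _ _ _ _ _ _ _ Tint Text, l + 1 =>
      Tint.levelVertices l + Text.levelVertices l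

/-! The total over a level is controlled by a potential. For a map `M` with `V` vertices, `E` edges
and `L` leaves, `M.potential` is `2E + 2L + 1 - 2V`. Three facts carry the proof.

If `M` is connected and no vertex of degree two can be merged, then `V` is at most the potential
(`RecNode.numVertices_le_potential`): with a weight of one per dart and two more per leaf, every
vertex receives at least three. The only exception is a single vertex with a loop, which the summand
`1` covers.

Merging at a vertex of degree two never raises the potential (`merge_potential_le`): two darts and
at most one vertex disappear, and no leaf is created.

Cutting along a cut-cycle raises the sum of the potentials by at most the constant 9, however long
the cycle is (`IsSplit.potential_le`). Every edge of the walk is doubled, which costs two darts, but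
every vertex passed on the way is split, which pays for them; since the walk does not turn back, no
leaf appears there. Only the start and the closing of the walk cost something.

Every split uses up one index of the path, so a recursion tree has at most `π.length` splits, and
the vertices at a level number at most the potential of the root plus `9 * π.length`
(`RecursionTree.levelVertices_le`). At the root, the number of darts and the length of the path are
both `O(r + B)`, where `B` is the total number of border vertices (`card_contracted_le`,
`IsDividingPath.length_le`), and `B` is `O(n / √r)` by the bounds of the partition. The argument
needs the root to be connected; this is `contracted_isMap`. -/

open Equiv

/-! ### Orbits of permutations and transport along them -/

/-- `x` and `y` lie in the same orbit of the group generated by `σ` and `α`. -/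
def Linked {A : Type*} (σ α : Perm A) : A → A → Prop :=
  Relation.EqvGen fun x y => y = σ x ∨ y = α x

/-- The predicate `P` must be invariant in both directions because the generated equivalence also
runs backwards. In the applications `P` often restricts to the darts of a map, outside which the
permutations carry no information. -/
theorem eqvGen_lift {A B : Type*} {r : A → A → Prop} {R : B → B → Prop} (hR : Equivalence R)
    {P : A → Prop} (hP : ∀ x y, r x y → (P x ↔ P y)) {f : A → B}
    (h : ∀ x y, P x → r x y → R (f x) (f y)) {x y : A} (hxy : Relation.EqvGen r x y) (hx : P x) :
    R (f x) (f y) := by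
  have key : (P x ↔ P y) ∧ (P x → R (f x) (f y)) := by
    clear hx
    induction hxy with
    | rel x y hr => exact ⟨hP x y hr, fun hx => h x y hx hr⟩
    | refl x => exact ⟨Iff.rfl, fun _ => hR.refl _⟩
    | symm x y _ ih => exact ⟨ih.1.symm, fun hy => hR.symm (ih.2 (ih.1.2 hy))⟩
    | trans x y z _ _ ih₁ ih₂ =>
      exact ⟨ih₁.1.trans ih₂.1, fun hx => hR.trans (ih₁.2 hx) (ih₂.2 (ih₁.1.1 hx))⟩
  exact key.2 hx

namespace Linked

variable {A : Type*} {σ α : Perm A}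

theorem refl (x : A) : Linked σ α x x := Relation.EqvGen.refl x

theorem symm {x y : A} (h : Linked σ α x y) : Linked σ α y x := Relation.EqvGen.symm _ _ h

theorem trans {x y z : A} (h : Linked σ α x y) (h' : Linked σ α y z) : Linked σ α x z :=
  Relation.EqvGen.trans _ _ _ h h'

theorem equivalence : Equivalence (Linked σ α) := ⟨refl, symm, trans⟩

theorem left (x : A) : Linked σ α x (σ x) := .rel _ _ (Or.inl rfl)

theorem right (x : A) : Linked σ α x (α x) := .rel _ _ (Or.inr rfl)

theorem mem_orbit_iff {x y : A} :
    y ∈ MulAction.orbit (Subgroup.closure ({σ, α} : Set (Perm A))) x ↔ Linked σ α x y := by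
  constructor
  · rintro ⟨⟨g, hg⟩, rfl⟩
    change Linked σ α x (g x)
    induction hg using Subgroup.closure_induction generalizing x with
    | mem g hg =>
      rcases hg with rfl | rfl
      · exact left x
      · exact right x
    | one => exact refl x
    | mul g h _ _ ihg ihh => exact (ihh (x := x)).trans ihg
    | inv g _ ih => simpa using (ih (x := g⁻¹ x)).symm
  · intro h
    induction h with
    | rel x y h =>
      rcases h with rfl | rfl
      · exact ⟨⟨σ, Subgroup.subset_closure (by simp)⟩, rfl⟩
      · exact ⟨⟨α, Subgroup.subset_closure (by simp)⟩, rfl⟩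
    | refl x => exact MulAction.mem_orbit_self x
    | symm x y _ ih => exact MulAction.mem_orbit_symm.1 ih
    | trans x y z _ _ ih₁ ih₂ =>
      rw [← MulAction.orbit_eq_iff] at ih₁ ih₂ ⊢
      rw [ih₂, ih₁]

theorem of_sameCycle {x y : A} (h : σ.SameCycle x y) : Linked σ α x y := by
  rw [← mem_orbit_iff]
  obtain ⟨k, rfl⟩ := h
  exact ⟨⟨σ ^ k, zpow_mem (Subgroup.subset_closure (by simp)) k⟩, rfl⟩

end Linked

theorem Equiv.Perm.SameCycle.lift {A B : Type*} {σ : Perm A} {R : B → B → Prop}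
    (hR : Equivalence R) {P : A → Prop} (hP : ∀ x, P x ↔ P (σ x)) {f : A → B}
    (h : ∀ x, P x → R (f x) (f (σ x))) {x y : A} (hxy : σ.SameCycle x y) (hx : P x) :
    R (f x) (f y) := by
  refine eqvGen_lift hR (P := P) (r := fun x y => y = σ x ∨ y = σ x) ?_ ?_
    (Linked.of_sameCycle (α := σ) hxy) hx
  · rintro x y (rfl | rfl) <;> exact hP x
  · rintro x y hx (rfl | rfl) <;> exact h x hx

theorem Equiv.Perm.SameCycle.eq_of_invariant {A B : Type*} {σ : Perm A} {P : A → Prop}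
    (hP : ∀ x, P x ↔ P (σ x)) {f : A → B} (h : ∀ x, P x → f (σ x) = f x) {x y : A}
    (hxy : σ.SameCycle x y) (hx : P x) : f x = f y :=
  hxy.lift eq_equivalence hP (fun x hx => (h x hx).symm) hx

/-- An injective self-map of a finite set is onto, so forward invariance is enough. -/
theorem mem_iff_of_mapsTo {A : Type*} {f : Perm A} {s : Finset A} (h : ∀ x ∈ s, f x ∈ s) (x : A) :
    x ∈ s ↔ f x ∈ s :=
  ⟨h x, fun hx => by simpa using Perm.perm_symm_on_of_perm_on_finset h hx⟩

/-- Multiplying by a transposition of two elements of one cycle splits this cycle. -/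
theorem not_sameCycle_mul_swap {A : Type*} [DecidableEq A] {σ : Perm A} {x y : A} (hne : x ≠ y)
    (h : σ.SameCycle x y) : ¬ (σ * swap x y).SameCycle x y := by
  have key : ∀ {x y : A} (k : ℕ), x ≠ y → (σ ^ k) x = y → ¬ (σ * swap x y).SameCycle x y := by
    intro x y k hne hk
    classical
    have hex : ∃ k : ℕ, (σ ^ k) x = y := ⟨k, hk⟩
    clear hk k
    -- Minimality makes `y` the first hit, so that the arc from `σ x` to `y` avoids `x`.
    obtain ⟨k, hk, hmin⟩ : ∃ k : ℕ, (σ ^ k) x = y ∧ ∀ j < k, (σ ^ j) x ≠ y :=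
      ⟨Nat.find hex, Nat.find_spec hex, fun j hj => Nat.find_min hex hj⟩
    have hk0 : 0 < k := by
      rcases Nat.eq_zero_or_pos k with rfl | h
      · exact absurd hk hne
      · exact h
    -- The new permutation sends the end `y` of this arc back to its beginning `σ x`. The arc is
    -- therefore invariant, and it contains `y` but not `x`.
    let T : Finset A := (Finset.Icc 1 k).image fun j => (σ ^ j) x
    have hyT : y ∈ T := Finset.mem_image.2 ⟨k, by simp; omega, hk⟩
    have hxT : x ∉ T := by
      intro hx
      obtain ⟨j, hj, hjx⟩ := Finset.mem_image.1 hx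
      rw [Finset.mem_Icc] at hj
      rcases hj.2.eq_or_lt with rfl | hlt
      · exact hne (hjx.symm.trans hk)
      · apply hmin (k - j) (by omega)
        have : (σ ^ (k - j)) ((σ ^ j) x) = y := by
          rw [← Perm.mul_apply, ← pow_add, Nat.sub_add_cancel hlt.le, hk]
        simpa only [hjx] using this
    have hT : ∀ z ∈ T, (σ * swap x y) z ∈ T := by
      intro z hz
      obtain ⟨j, hj, rfl⟩ := Finset.mem_image.1 hz
      rw [Finset.mem_Icc] at hj
      rcases hj.2.eq_or_lt with rfl | hlt
      · simp only [hk, Perm.mul_apply, swap_apply_right]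
        exact Finset.mem_image.2 ⟨1, by simp; omega, by simp⟩
      · have h1 : (σ ^ j) x ≠ x := fun h => hxT (h ▸ hz)
        rw [Perm.mul_apply, swap_apply_of_ne_of_ne h1 (hmin j hlt)]
        exact Finset.mem_image.2 ⟨j + 1, by simp; omega, by rw [pow_succ']; rfl⟩
    intro hc
    exact hxT ((hc.lift (R := fun p q : Prop => p ↔ q) ⟨fun _ => Iff.rfl, Iff.symm, Iff.trans⟩
      (P := fun _ => True) (f := fun z => z ∈ T) (by simp) (fun z _ => mem_iff_of_mapsTo hT z) trivial).2 hyT)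
  obtain ⟨k, hk⟩ := h
  obtain ⟨n, rfl | rfl⟩ := k.eq_nat_or_neg
  · exact key n hne (by simpa using hk)
  · rw [swap_comm]
    refine fun hc => key (x := y) (y := x) n hne.symm ?_ hc.symm
    rw [← hk]
    simp

/-! ### Connected maps, vertex counts and the potential -/

namespace PlaneMap

variable {A V : Type*}

/-- `M` is a connected graph with a rotation system. -/
structure IsMap (M : PlaneMap A V) : Prop where
  sigma_mem : ∀ x ∈ M.darts, M.σ x ∈ M.darts
  alpha_mem : ∀ x ∈ M.darts, M.α x ∈ M.darts
  alpha_alpha : ∀ x ∈ M.darts, M.α (M.α x) = x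
  alpha_ne : ∀ x ∈ M.darts, M.α x ≠ x
  linked : ∀ x ∈ M.darts, ∀ y ∈ M.darts, Linked M.σ M.α x y

/-- The set of the darts at the origin of `d`. -/
def orb (M : PlaneMap A V) (d : A) : Set A := {e | M.σ.SameCycle d e}

theorem orb_eq_iff {M : PlaneMap A V} {x y : A} : M.orb x = M.orb y ↔ M.σ.SameCycle x y := by
  constructor
  · intro h
    have : y ∈ M.orb x := h ▸ Perm.SameCycle.refl _ _
    exact this
  · intro h
    ext z
    exact ⟨fun hz => h.symm.trans hz, fun hz => h.trans hz⟩

theorem orb_sigma (M : PlaneMap A V) (x : A) : M.orb (M.σ x) = M.orb x :=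
  orb_eq_iff.2 (Perm.SameCycle.refl _ _).apply_left

theorem IsMap.lift {M : PlaneMap A V} (hM : M.IsMap) {B : Type*} {R : B → B → Prop}
    (hR : Equivalence R) {f : A → B} (hσ : ∀ x ∈ M.darts, R (f x) (f (M.σ x)))
    (hα : ∀ x ∈ M.darts, R (f x) (f (M.α x))) {x y : A} (hx : x ∈ M.darts) (hy : y ∈ M.darts) :
    R (f x) (f y) := by
  refine eqvGen_lift hR (P := (· ∈ M.darts)) ?_ ?_ (hM.linked x hx y hy) hx
  · rintro x y (rfl | rfl)
    exacts [mem_iff_of_mapsTo hM.sigma_mem x, mem_iff_of_mapsTo hM.alpha_mem x]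
  · rintro x y hx (rfl | rfl)
    exacts [hσ x hx, hα x hx]

/-- All lower bounds on vertex counts below come from this: a function that is constant on the
vertices takes at most as many values as there are vertices, so a suitable colouring by old orbits
shows that few vertices are lost. -/
theorem ncard_image_le_numVertices (M : PlaneMap A V) (hσ : ∀ x ∈ M.darts, M.σ x ∈ M.darts)
    {B : Type*} (f : A → B) (hf : ∀ x ∈ M.darts, f (M.σ x) = f x) :
    (f '' (M.darts : Set A)).ncard ≤ M.numVertices := by
  classical
  have hinv : ∀ x ∈ M.darts, ∀ y, M.σ.SameCycle x y → f x = f y := fun x hx y h =>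
    h.eq_of_invariant (mem_iff_of_mapsTo hσ) hf hx
  refine Set.ncard_le_ncard_of_injOn
    (fun b => if h : ∃ x ∈ M.darts, f x = b then M.orb h.choose else ∅) ?_ ?_
    ((M.darts.finite_toSet).image _)
  · rintro _ ⟨x, hx, rfl⟩
    have h : ∃ y ∈ M.darts, f y = f x := ⟨x, hx, rfl⟩
    simp only [dif_pos h]
    exact ⟨_, h.choose_spec.1, rfl⟩
  · rintro _ ⟨x, hx, rfl⟩ _ ⟨y, hy, rfl⟩ hxy
    have h : ∃ z ∈ M.darts, f z = f x := ⟨x, hx, rfl⟩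
    have h' : ∃ z ∈ M.darts, f z = f y := ⟨y, hy, rfl⟩
    simp only [dif_pos h, dif_pos h'] at hxy
    rw [← h.choose_spec.2, ← h'.choose_spec.2]
    exact hinv _ h.choose_spec.1 _ (orb_eq_iff.1 hxy)

theorem numVertices_eq (M : PlaneMap A V) : M.numVertices = (M.orb '' (M.darts : Set A)).ncard :=
  rfl

/-- The darts at the vertices of degree one. -/
def leaves (M : PlaneMap A V) : Set A := {x | x ∈ M.darts ∧ M.σ x = x}

theorem finite_leaves (M : PlaneMap A V) : M.leaves.Finite :=
  M.darts.finite_toSet.subset fun _ hx => hx.1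

/-- The number of vertices of degree one. -/
noncomputable def numLeaves (M : PlaneMap A V) : ℕ := M.leaves.ncard

/-- The potential that bounds the number of vertices after the removal of those of degree two. -/
noncomputable def potential (M : PlaneMap A V) : ℤ :=
  M.darts.card + 2 * M.numLeaves + 1 - 2 * M.numVertices

theorem numLeaves_le {M N : PlaneMap A V} (h : N.leaves ⊆ M.leaves) : N.numLeaves ≤ M.numLeaves :=
  Set.ncard_le_ncard h M.finite_leaves

/-! ### Doubling an edge -/

section double

variable {M : PlaneMap A V} {a a' b' : A}

theorem Fresh.ne_of_mem {x y : A} (h : M.Fresh y) (hx : x ∈ M.darts) : x ≠ y :=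
  fun he => h.1 (he ▸ hx)

variable [DecidableEq A]

/-- The values of the permutations of `M.double a a' b'`. -/
structure DoubleSpec (M : PlaneMap A V) (a a' b' : A) : Prop where
  sigma_fst : (M.double a a' b').σ a' = a
  sigma_snd : (M.double a a' b').σ b' = M.α a
  sigma_of_eq_fst : ∀ x ∈ M.darts, M.σ x = a → (M.double a a' b').σ x = a'
  sigma_of_eq_snd : ∀ x ∈ M.darts, M.σ x = M.α a → (M.double a a' b').σ x = b'
  sigma_of_ne : ∀ x ∈ M.darts, M.σ x ≠ a → M.σ x ≠ M.α a → (M.double a a' b').σ x = M.σ x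
  alpha_a : (M.double a a' b').α a = b'
  alpha_fst : (M.double a a' b').α a' = M.α a
  alpha_snd : (M.double a a' b').α b' = a
  alpha_alpha : (M.double a a' b').α (M.α a) = a'
  alpha_of_ne : ∀ x ∈ M.darts, x ≠ a → x ≠ M.α a → (M.double a a' b').α x = M.α x

theorem doubleSpec (hM : M.IsMap) (ha : a ∈ M.darts) (ha' : M.Fresh a') (hb' : M.Fresh b')
    (hne : a' ≠ b') : DoubleSpec M a a' b' := by
  have h1 : M.α a ∈ M.darts := hM.alpha_mem a ha
  have h2 : M.α (M.α a) = a := hM.alpha_alpha a ha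
  have h3 : M.α a ≠ a := hM.alpha_ne a ha
  have n1 := ha'.ne_of_mem ha
  have n2 := ha'.ne_of_mem h1
  have n3 := hb'.ne_of_mem ha
  have n4 := hb'.ne_of_mem h1
  have e1 := ha'.2.1
  have e2 := ha'.2.2
  have e3 := hb'.2.1
  have e4 := hb'.2.2
  constructor
  · simp only [double, Perm.mul_apply, swap_apply_def]; grind
  · simp only [double, Perm.mul_apply, swap_apply_def]; grind
  · intro x hx hxa
    have := ha'.ne_of_mem (hM.sigma_mem x hx)
    have := hb'.ne_of_mem (hM.sigma_mem x hx)
    simp only [double, Perm.mul_apply, swap_apply_def]; grind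
  · intro x hx hxa
    have := ha'.ne_of_mem (hM.sigma_mem x hx)
    have := hb'.ne_of_mem (hM.sigma_mem x hx)
    simp only [double, Perm.mul_apply, swap_apply_def]; grind
  · intro x hx hxa hxb
    have := ha'.ne_of_mem (hM.sigma_mem x hx)
    have := hb'.ne_of_mem (hM.sigma_mem x hx)
    simp only [double, Perm.mul_apply, swap_apply_def]; grind
  · simp only [double, Perm.mul_apply, swap_apply_def]; grind
  · simp only [double, Perm.mul_apply, swap_apply_def]; grind
  · simp only [double, Perm.mul_apply, swap_apply_def]; grind
  · simp only [double, Perm.mul_apply, swap_apply_def]; grind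
  · intro x hx hxa hxb
    have := ha'.ne_of_mem hx
    have := hb'.ne_of_mem hx
    have := ha'.ne_of_mem (hM.alpha_mem x hx)
    have := hb'.ne_of_mem (hM.alpha_mem x hx)
    have := hM.alpha_alpha x hx
    simp only [double, Perm.mul_apply, swap_apply_def]; grind

theorem mem_double {x : A} : x ∈ (M.double a a' b').darts ↔ x = a' ∨ x = b' ∨ x ∈ M.darts := by
  simp [double]

theorem card_double (ha' : M.Fresh a') (hb' : M.Fresh b') (hne : a' ≠ b') :
    (M.double a a' b').darts.card = M.darts.card + 2 := by
  rw [double, Finset.card_insert_of_notMem, Finset.card_insert_of_notMem hb'.1]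
  simp [hne, ha'.1]

/-- A step of the old map becomes at most two steps of the new one: the rotation may make a stop at
`a'` or `b'`, and the reversal of the doubled edge passes through the parallel copy. -/
theorem double_linked (hM : M.IsMap) (S : DoubleSpec M a a' b') {x y : A}
    (hx : x ∈ M.darts) (hy : y ∈ M.darts) :
    Linked (M.double a a' b').σ (M.double a a' b').α x y := by
  refine hM.lift Linked.equivalence (f := id) (fun x hx => ?_) (fun x hx => ?_) hx hy
  · simp only [id]
    by_cases h1 : M.σ x = a
    · have e := Linked.left (σ := (M.double a a' b').σ) (α := (M.double a a' b').α) x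
      have e' := Linked.left (σ := (M.double a a' b').σ) (α := (M.double a a' b').α) a'
      rw [S.sigma_of_eq_fst x hx h1] at e
      rw [S.sigma_fst] at e'
      exact h1 ▸ e.trans e'
    by_cases h2 : M.σ x = M.α a
    · have e := Linked.left (σ := (M.double a a' b').σ) (α := (M.double a a' b').α) x
      have e' := Linked.left (σ := (M.double a a' b').σ) (α := (M.double a a' b').α) b'
      rw [S.sigma_of_eq_snd x hx h2] at e
      rw [S.sigma_snd] at e'
      exact h2 ▸ e.trans e'
    · have e := Linked.left (σ := (M.double a a' b').σ) (α := (M.double a a' b').α) x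
      rwa [S.sigma_of_ne x hx h1 h2] at e
  · simp only [id]
    have e1 := Linked.right (σ := (M.double a a' b').σ) (α := (M.double a a' b').α) x
    by_cases h1 : x = a
    · subst h1
      have e2 := Linked.left (σ := (M.double x a' b').σ) (α := (M.double x a' b').α) b'
      rw [S.alpha_a] at e1
      rw [S.sigma_snd] at e2
      exact e1.trans e2
    by_cases h2 : x = M.α a
    · have e2 := Linked.left (σ := (M.double a a' b').σ) (α := (M.double a a' b').α) a'
      rw [h2, S.alpha_alpha] at e1
      rw [S.sigma_fst] at e2
      have ha : M.α x = a := by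
        have := hM.alpha_alpha x hx
        rw [h2] at this ⊢
        exact M.α.injective this
      rw [ha, h2]
      exact e1.trans e2
    · rwa [S.alpha_of_ne x hx h1 h2] at e1

theorem IsMap.double (hM : M.IsMap) (ha : a ∈ M.darts) (ha' : M.Fresh a') (hb' : M.Fresh b')
    (hne : a' ≠ b') : (M.double a a' b').IsMap := by
  have S := doubleSpec hM ha ha' hb' hne
  have h1 := hM.alpha_mem a ha
  have h2 := hM.alpha_alpha a ha
  constructor
  · intro x hx
    rw [mem_double] at hx ⊢
    rcases hx with rfl | rfl | hx
    · rw [S.sigma_fst]; tauto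
    · rw [S.sigma_snd]; tauto
    · by_cases e1 : M.σ x = a
      · rw [S.sigma_of_eq_fst x hx e1]; tauto
      by_cases e2 : M.σ x = M.α a
      · rw [S.sigma_of_eq_snd x hx e2]; tauto
      rw [S.sigma_of_ne x hx e1 e2]
      have := hM.sigma_mem x hx
      tauto
  · intro x hx
    rw [mem_double] at hx ⊢
    rcases hx with rfl | rfl | hx
    · rw [S.alpha_fst]; tauto
    · rw [S.alpha_snd]; tauto
    · by_cases e1 : x = a
      · rw [e1, S.alpha_a]; tauto
      by_cases e2 : x = M.α a
      · rw [e2, S.alpha_alpha]; tauto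
      rw [S.alpha_of_ne x hx e1 e2]
      have := hM.alpha_mem x hx
      tauto
  · intro x hx
    rw [mem_double] at hx
    rcases hx with rfl | rfl | hx
    · rw [S.alpha_fst, S.alpha_alpha]
    · rw [S.alpha_snd, S.alpha_a]
    · by_cases e1 : x = a
      · rw [e1, S.alpha_a, S.alpha_snd]
      by_cases e2 : x = M.α a
      · rw [e2, S.alpha_alpha, S.alpha_fst]
      rw [S.alpha_of_ne x hx e1 e2, S.alpha_of_ne _ (hM.alpha_mem x hx), hM.alpha_alpha x hx]
      · intro h; exact e2 (by rw [← h, hM.alpha_alpha x hx])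
      · exact fun h => e1 (M.α.injective h)
  · intro x hx
    rw [mem_double] at hx
    rcases hx with rfl | rfl | hx
    · rw [S.alpha_fst]; exact ha'.ne_of_mem h1
    · rw [S.alpha_snd]; exact hb'.ne_of_mem ha
    · by_cases e1 : x = a
      · rw [e1, S.alpha_a]; exact (hb'.ne_of_mem ha).symm
      by_cases e2 : x = M.α a
      · rw [e2, S.alpha_alpha]; exact (ha'.ne_of_mem h1).symm
      rw [S.alpha_of_ne x hx e1 e2]; exact hM.alpha_ne x hx
  · have key : ∀ x ∈ (M.double a a' b').darts,
        Linked (M.double a a' b').σ (M.double a a' b').α x a := by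
      intro x hx
      rw [mem_double] at hx
      rcases hx with rfl | rfl | hx
      · have e := Linked.left (σ := (M.double a x b').σ) (α := (M.double a x b').α) x
        rwa [S.sigma_fst] at e
      · have e := Linked.right (σ := (M.double a a' x).σ) (α := (M.double a a' x).α) x
        rwa [S.alpha_snd] at e
      · exact double_linked hM S hx ha
    exact fun x hx y hy => (key x hx).trans (key y hy).symm

/-- The new darts are coloured by the old vertices into which they are inserted, so the old orbits
remain an invariant of the new rotation. -/
theorem numVertices_le_double (hM : M.IsMap) (ha : a ∈ M.darts) (ha' : M.Fresh a')
    (hb' : M.Fresh b') (hne : a' ≠ b') : M.numVertices ≤ (M.double a a' b').numVertices := by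
  have S := doubleSpec hM ha ha' hb' hne
  have hM' := hM.double ha ha' hb' hne
  let f : A → Set A := fun x => if x = a' then M.orb a else if x = b' then M.orb (M.α a) else
    M.orb x
  have f1 : f a' = M.orb a := by simp [f]
  have f2 : f b' = M.orb (M.α a) := by simp [f, hne.symm]
  have f3 : ∀ x ∈ M.darts, f x = M.orb x := fun x hx => by
    simp [f, ha'.ne_of_mem hx, hb'.ne_of_mem hx]
  refine le_trans ?_ (ncard_image_le_numVertices _ hM'.sigma_mem f ?_)
  · rw [numVertices_eq]
    refine Set.ncard_le_ncard ?_ ((Finset.finite_toSet _).image _)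
    rintro _ ⟨x, hx, rfl⟩
    exact ⟨x, mem_double.2 (Or.inr (Or.inr hx)), f3 x hx⟩
  · intro x hx
    rw [mem_double] at hx
    rcases hx with rfl | rfl | hx
    · rw [S.sigma_fst, f1, f3 a ha]
    · rw [S.sigma_snd, f2, f3 _ (hM.alpha_mem a ha)]
    · by_cases e1 : M.σ x = a
      · rw [S.sigma_of_eq_fst x hx e1, f1, f3 x hx, ← e1, orb_sigma]
      by_cases e2 : M.σ x = M.α a
      · rw [S.sigma_of_eq_snd x hx e2, f2, f3 x hx, ← e2, orb_sigma]
      rw [S.sigma_of_ne x hx e1 e2, f3 x hx, f3 _ (hM.sigma_mem x hx), orb_sigma]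

theorem leaves_double_subset (hM : M.IsMap) (ha : a ∈ M.darts) (ha' : M.Fresh a')
    (hb' : M.Fresh b') (hne : a' ≠ b') : (M.double a a' b').leaves ⊆ M.leaves := by
  rintro x ⟨hx, h⟩
  have S := doubleSpec hM ha ha' hb' hne
  rw [mem_double] at hx
  rcases hx with rfl | rfl | hx
  · rw [S.sigma_fst] at h; exact absurd h (ha'.ne_of_mem ha)
  · rw [S.sigma_snd] at h; exact absurd h (hb'.ne_of_mem (hM.alpha_mem a ha))
  · by_cases e1 : M.σ x = a
    · rw [S.sigma_of_eq_fst x hx e1] at h; exact absurd h.symm (ha'.ne_of_mem hx)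
    by_cases e2 : M.σ x = M.α a
    · rw [S.sigma_of_eq_snd x hx e2] at h; exact absurd h.symm (hb'.ne_of_mem hx)
    rw [S.sigma_of_ne x hx e1 e2] at h
    exact ⟨hx, h⟩

theorem double_sameCycle (hM : M.IsMap) (ha : a ∈ M.darts) (ha' : M.Fresh a')
    (hb' : M.Fresh b') (hne : a' ≠ b') {x y : A} (hx : x ∈ M.darts) (h : M.σ.SameCycle x y) :
    (M.double a a' b').σ.SameCycle x y := by
  have S := doubleSpec hM ha ha' hb' hne
  refine h.lift (R := (M.double a a' b').σ.SameCycle)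
    ⟨Perm.SameCycle.refl _, Perm.SameCycle.symm, Perm.SameCycle.trans⟩ (f := id)
    (mem_iff_of_mapsTo hM.sigma_mem) (fun x hx => ?_) hx
  simp only [id]
  have e : (M.double a a' b').σ.SameCycle x ((M.double a a' b').σ x) :=
    (Perm.SameCycle.refl _ _).apply_right
  by_cases e1 : M.σ x = a
  · rw [S.sigma_of_eq_fst x hx e1, ← Perm.sameCycle_apply_right, S.sigma_fst] at e
    rwa [e1]
  by_cases e2 : M.σ x = M.α a
  · rw [S.sigma_of_eq_snd x hx e2, ← Perm.sameCycle_apply_right, S.sigma_snd] at e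
    rwa [e2]
  rwa [S.sigma_of_ne x hx e1 e2] at e

end double

/-! ### Cutting through a vertex -/

section splitAt

variable [DecidableEq A] {M : PlaneMap A V} {x y : A}

theorem splitAt_sigma_left : (M.splitAt x y).σ x = M.σ y := by simp [splitAt]

theorem splitAt_sigma_right : (M.splitAt x y).σ y = M.σ x := by simp [splitAt]

theorem splitAt_sigma_of_ne {z : A} (hx : z ≠ x) (hy : z ≠ y) : (M.splitAt x y).σ z = M.σ z := by
  simp [splitAt, swap_apply_of_ne_of_ne hx hy]

theorem splitAt_sigma_mem (hM : M.IsMap) (hx : x ∈ M.darts) (hy : y ∈ M.darts) :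
    ∀ z ∈ M.darts, (M.splitAt x y).σ z ∈ M.darts := by
  intro z hz
  by_cases h1 : z = x
  · rw [h1, splitAt_sigma_left]; exact hM.sigma_mem y hy
  by_cases h2 : z = y
  · rw [h2, splitAt_sigma_right]; exact hM.sigma_mem x hx
  rw [splitAt_sigma_of_ne h1 h2]; exact hM.sigma_mem z hz

/-- Cutting a vertex leaves the graph connected if it does not disconnect the two corners. -/
theorem splitAt_linked (hM : M.IsMap) {R : A → A → Prop} (hR : Equivalence R)
    (hle : ∀ z w, Linked (M.splitAt x y).σ (M.splitAt x y).α z w → R z w) (hxy : R x y) {z w : A}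
    (hz : z ∈ M.darts) (hw : w ∈ M.darts) : R z w := by
  refine hM.lift hR (f := id) (fun z hz => ?_) (fun z hz => hle _ _ (Linked.right z)) hz hw
  simp only [id]
  by_cases h1 : z = x
  · subst h1
    refine hR.trans hxy (hle _ _ ?_)
    have e := Linked.left (σ := (M.splitAt z y).σ) (α := (M.splitAt z y).α) y
    rwa [splitAt_sigma_right] at e
  by_cases h2 : z = y
  · subst h2
    refine hR.trans (hR.symm hxy) (hle _ _ ?_)
    have e := Linked.left (σ := (M.splitAt x z).σ) (α := (M.splitAt x z).α) x
    rwa [splitAt_sigma_left] at e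
  have e := Linked.left (σ := (M.splitAt x y).σ) (α := (M.splitAt x y).α) z
  rw [splitAt_sigma_of_ne h1 h2] at e
  exact hle _ _ e

theorem IsMap.splitAt (hM : M.IsMap) (hx : x ∈ M.darts) (hy : y ∈ M.darts)
    (hxy : Linked (M.splitAt x y).σ (M.splitAt x y).α x y) : (M.splitAt x y).IsMap :=
  ⟨splitAt_sigma_mem hM hx hy, hM.alpha_mem, hM.alpha_alpha, hM.alpha_ne, fun _ hz _ hw =>
    splitAt_linked hM Linked.equivalence (fun _ _ h => h) hxy hz hw⟩

/-- The old orbit together with membership in the new orbit of `x` is an invariant that takes two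
values on the vertex being cut. -/
theorem numVertices_lt_splitAt (hM : M.IsMap) (hx : x ∈ M.darts) (hy : y ∈ M.darts)
    (hne : x ≠ y) (h : M.σ.SameCycle x y) : M.numVertices + 1 ≤ (M.splitAt x y).numVertices := by
  have hnot : ¬ (M.splitAt x y).σ.SameCycle x y := not_sameCycle_mul_swap hne h
  let f : A → Set A × Prop := fun z => (M.orb z, (M.splitAt x y).σ.SameCycle x z)
  refine le_trans ?_ (ncard_image_le_numVertices _ (splitAt_sigma_mem hM hx hy) f ?_)
  · have hfin : (f '' (M.darts : Set A)).Finite := (Finset.finite_toSet _).image _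
    have hmem : f x ∈ f '' (M.darts : Set A) := ⟨x, hx, rfl⟩
    have h1 := Set.ncard_sdiff_singleton_add_one hmem hfin
    change _ ≤ (f '' (M.darts : Set A)).ncard
    rw [← h1, numVertices_eq]
    refine Nat.succ_le_succ (le_trans (Set.ncard_le_ncard (t := Prod.fst '' _) ?_
      ((hfin.sdiff).image _)) (Set.ncard_image_le hfin.sdiff))
    rintro _ ⟨z, hz, rfl⟩
    by_cases hzx : f z = f x
    · refine ⟨f y, ⟨⟨y, hy, rfl⟩, fun hyx => hnot ?_⟩, ?_⟩
      · have : (M.splitAt x y).σ.SameCycle x y = (M.splitAt x y).σ.SameCycle x x :=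
          congrArg Prod.snd hyx
        rw [this]
      · have := congrArg Prod.fst hzx
        exact (orb_eq_iff.2 h.symm).trans this.symm
    · exact ⟨f z, ⟨⟨z, hz, rfl⟩, hzx⟩, rfl⟩
  · intro z _
    refine Prod.ext ?_ (propext Perm.sameCycle_apply_right)
    change M.orb _ = M.orb z
    by_cases h1 : z = x
    · rw [h1, splitAt_sigma_left, orb_sigma, orb_eq_iff]; exact h.symm
    by_cases h2 : z = y
    · rw [h2, splitAt_sigma_right, orb_sigma, orb_eq_iff]; exact h
    rw [splitAt_sigma_of_ne h1 h2, orb_sigma]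

-- The corners need not belong to one vertex here. If they do not, the transposition joins their
-- vertices; identifying the two old orbits gives an invariant, at the price of one value.
open Classical in
theorem numVertices_le_splitAt (hM : M.IsMap) (hx : x ∈ M.darts) (hy : y ∈ M.darts) :
    M.numVertices ≤ (M.splitAt x y).numVertices + 1 := by
  let f : A → Set A := fun z => if M.orb z = M.orb x then M.orb y else M.orb z
  have fx : f x = M.orb y := by simp [f]
  have fy : f y = M.orb y := by simp [f]
  have fσ : ∀ z, f (M.σ z) = f z := fun z => by simp only [f, orb_sigma]
  have key := ncard_image_le_numVertices (M.splitAt x y) (splitAt_sigma_mem hM hx hy) f (fun z _ => by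
    by_cases h1 : z = x
    · rw [h1, splitAt_sigma_left, fσ, fx]; exact fy
    by_cases h2 : z = y
    · rw [h2, splitAt_sigma_right, fσ, fx]; exact fy.symm
    rw [splitAt_sigma_of_ne h1 h2, fσ])
  have h1 := Set.ncard_le_ncard_sdiff_add_ncard (M.orb '' (M.darts : Set A)) {M.orb x}
  rw [Set.ncard_singleton, ← numVertices_eq] at h1
  refine h1.trans (Nat.succ_le_succ (le_trans (Set.ncard_le_ncard ?_
    ((Finset.finite_toSet _).image _)) key))
  rintro _ ⟨⟨z, hz, rfl⟩, hzx⟩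
  exact ⟨z, hz, if_neg hzx⟩

theorem leaves_splitAt_subset : (M.splitAt x y).leaves ⊆ M.leaves ∪ {x, y} := by
  rintro z ⟨hz, h⟩
  by_cases h1 : z = x
  · exact Or.inr (Or.inl h1)
  by_cases h2 : z = y
  · exact Or.inr (Or.inr h2)
  exact Or.inl ⟨hz, (splitAt_sigma_of_ne h1 h2).symm.trans h⟩

theorem numLeaves_splitAt_le : (M.splitAt x y).numLeaves ≤ M.numLeaves + 2 := by
  refine (Set.ncard_le_ncard leaves_splitAt_subset
    (M.finite_leaves.union (Set.toFinite _))).trans ((Set.ncard_union_le _ _).trans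
    (Nat.add_le_add_left ?_ _))
  exact (Set.ncard_insert_le _ _).trans (by rw [Set.ncard_singleton])

end splitAt

end PlaneMap

/-! ### Cutting along a walk and passing to components -/

namespace PlaneMap

variable {A V : Type*}

theorem mem_component {M : PlaneMap A V} {d e : A} :
    e ∈ M.component d ↔ e ∈ M.darts ∧ Linked M.σ M.α d e := by
  simp only [component, Finset.mem_filter, Linked.mem_orbit_iff]

theorem restrict_isMap {M : PlaneMap A V} (hσ : ∀ x ∈ M.darts, M.σ x ∈ M.darts)
    (hα : ∀ x ∈ M.darts, M.α x ∈ M.darts) (hαα : ∀ x ∈ M.darts, M.α (M.α x) = x)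
    (hne : ∀ x ∈ M.darts, M.α x ≠ x) (d : A) : (M.restrict d).IsMap := by
  have hmem : ∀ x, x ∈ (M.restrict d).darts ↔ x ∈ M.darts ∧ Linked M.σ M.α d x :=
    fun x => mem_component
  constructor
  · intro x hx
    rw [hmem] at hx ⊢
    exact ⟨hσ x hx.1, hx.2.trans (Linked.left x)⟩
  · intro x hx
    rw [hmem] at hx ⊢
    exact ⟨hα x hx.1, hx.2.trans (Linked.right x)⟩
  · exact fun x hx => hαα x ((hmem x).1 hx).1
  · exact fun x hx => hne x ((hmem x).1 hx).1
  · intro x hx y hy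
    exact ((hmem x).1 hx).2.symm.trans ((hmem y).1 hy).2

variable [DecidableEq A]

/-- The cost of the walk does not depend on its length: the first edge adds two darts, and every
later edge adds two darts together with a new vertex. The relation `N.σ b' = b` is the invariant
that locates the open end of the cut and lets the next step proceed. -/
theorem Slit.spec {M N : PlaneMap A V} {v : V} {a₀ b b' : A} {S : Set V} (hM : M.IsMap)
    (h : Slit M v N a₀ b b' S) :
    N.IsMap ∧ a₀ ∈ N.darts ∧ b ∈ N.darts ∧ b' ∈ N.darts ∧ N.σ b' = b ∧
      N.darts.card + 2 * M.numVertices ≤ M.darts.card + 2 * N.numVertices + 2 ∧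
      N.leaves ⊆ M.leaves := by
  induction h with
  | start a a' b' ha hv hne ha' hb' =>
    have S := doubleSpec hM ha ha' hb' hne
    refine ⟨hM.double ha ha' hb' hne, mem_double.2 (Or.inl rfl),
      mem_double.2 (Or.inr (Or.inr (hM.alpha_mem a ha))), mem_double.2 (Or.inr (Or.inl rfl)),
      S.sigma_snd, ?_, leaves_double_subset hM ha ha' hb' hne⟩
    have := numVertices_le_double hM ha ha' hb' hne
    have := card_double (a := a) ha' hb' hne
    omega
  | step N a₀ b b' T h hT a a₁ b₁ ha hab hb hb' hne ha₁ hb₁ ih =>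
    obtain ⟨hN, ha₀, hbN, hb'N, hσ, hcard, hleaves⟩ := ih
    have S := doubleSpec hN ha ha₁ hb₁ hne
    have hN1 := hN.double ha ha₁ hb₁ hne
    have m1 : ∀ x ∈ N.darts, x ∈ (N.double a a₁ b₁).darts := fun x hx =>
      mem_double.2 (Or.inr (Or.inr hx))
    have ma₁ : a₁ ∈ (N.double a a₁ b₁).darts := mem_double.2 (Or.inl rfl)
    have mb₁ : b₁ ∈ (N.double a a₁ b₁).darts := mem_double.2 (Or.inr (Or.inl rfl))
    have nb'a₁ : b' ≠ a₁ := ha₁.ne_of_mem hb'N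
    have nb'b₁ : b' ≠ b₁ := hb₁.ne_of_mem hb'N
    have σb₁ : ((N.double a a₁ b₁).splitAt b' a₁).σ b₁ = N.α a := by
      rw [splitAt_sigma_of_ne nb'b₁.symm hne.symm, S.sigma_snd]
    have σb' : ((N.double a a₁ b₁).splitAt b' a₁).σ b' = a := by
      rw [splitAt_sigma_left, S.sigma_fst]
    have hcycle : (N.double a a₁ b₁).σ.SameCycle b' a₁ := by
      have h1 : N.σ.SameCycle b' a := by
        rw [← Perm.sameCycle_apply_left, hσ]; exact hab
      rw [← Perm.sameCycle_apply_right, S.sigma_fst]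
      exact double_sameCycle hN ha ha₁ hb₁ hne hb'N h1
    -- The two sides of the vertex just split remain connected through the two copies of the new
    -- edge, which meet at its far end, not yet split.
    have hlink : Linked ((N.double a a₁ b₁).splitAt b' a₁).σ
        ((N.double a a₁ b₁).splitAt b' a₁).α b' a₁ := by
      have l1 := Linked.left (σ := ((N.double a a₁ b₁).splitAt b' a₁).σ)
        (α := ((N.double a a₁ b₁).splitAt b' a₁).α) b'
      have l2 := Linked.right (σ := ((N.double a a₁ b₁).splitAt b' a₁).σ)
        (α := ((N.double a a₁ b₁).splitAt b' a₁).α) b₁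
      have l3 := Linked.left (σ := ((N.double a a₁ b₁).splitAt b' a₁).σ)
        (α := ((N.double a a₁ b₁).splitAt b' a₁).α) b₁
      have l4 := Linked.right (σ := ((N.double a a₁ b₁).splitAt b' a₁).σ)
        (α := ((N.double a a₁ b₁).splitAt b' a₁).α) a₁
      rw [σb'] at l1
      rw [σb₁] at l3
      have e2 : ((N.double a a₁ b₁).splitAt b' a₁).α b₁ = a := S.alpha_snd
      have e4 : ((N.double a a₁ b₁).splitAt b' a₁).α a₁ = N.α a := S.alpha_fst
      rw [e2] at l2
      rw [e4] at l4
      exact l1.trans (l2.symm.trans (l3.trans l4.symm))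
    refine ⟨hN1.splitAt (m1 _ hb'N) ma₁ hlink, m1 _ ha₀, m1 _ (hN.alpha_mem a ha), mb₁, σb₁,
      ?_, ?_⟩
    · have h1 := numVertices_le_double hN ha ha₁ hb₁ hne
      have h2 := numVertices_lt_splitAt hN1 (m1 _ hb'N) ma₁ nb'a₁ hcycle
      have h3 := card_double (a := a) ha₁ hb₁ hne
      have h4 : ((N.double a a₁ b₁).splitAt b' a₁).darts.card = (N.double a a₁ b₁).darts.card := rfl
      omega
    · intro x hx
      rcases leaves_splitAt_subset hx with hx' | rfl | rfl
      · exact hleaves (leaves_double_subset hN ha ha₁ hb₁ hne hx')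
      -- A leaf at `b'` would force `a = b'`, and one at `a₁` is impossible because the walk does
      -- not turn back (`a ≠ b`): either side of the cut holds more than one dart.
      · exact absurd (σb'.symm.trans hx.2) hb'
      · have h1 := hx.2
        rw [splitAt_sigma_right] at h1
        by_cases h2 : b = N.α a
        · rw [S.sigma_of_eq_snd b' hb'N (hσ.trans h2)] at h1
          exact absurd h1 hne.symm
        · rw [S.sigma_of_ne b' hb'N (by rw [hσ]; exact hb.symm) (by rwa [hσ]), hσ] at h1
          exact absurd h1 (ha₁.ne_of_mem hbN)

/-- Darts and leaves of the two disjoint components are at most those of `M`, and their vertices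
cover those of `M`. The extra 1 arises because the constant of the potential is counted twice. -/
theorem potential_restrict_add_le {M : PlaneMap A V} {s t : A}
    (hcover : ∀ x ∈ M.darts, x ∈ M.component s ∨ x ∈ M.component t) (hst : ¬ Linked M.σ M.α s t) :
    (M.restrict s).potential + (M.restrict t).potential ≤ M.potential + 1 := by
  have hdisj : Disjoint (M.component s) (M.component t) := Finset.disjoint_left.2 fun x hx hx' =>
    hst ((mem_component.1 hx).2.trans (mem_component.1 hx').2.symm)
  have hD : (M.component s).card + (M.component t).card ≤ M.darts.card := by
    rw [← Finset.card_union_of_disjoint hdisj]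
    exact Finset.card_le_card (Finset.union_subset (fun x hx => (mem_component.1 hx).1)
      (fun x hx => (mem_component.1 hx).1))
  have hV : M.numVertices ≤ (M.restrict s).numVertices + (M.restrict t).numVertices := by
    refine le_trans ?_ (Set.ncard_union_le _ _)
    refine Set.ncard_le_ncard ?_
      (((Finset.finite_toSet _).image _).union ((Finset.finite_toSet _).image _))
    rintro _ ⟨x, hx, rfl⟩
    rcases hcover x hx with h | h
    exacts [Or.inl ⟨x, h, rfl⟩, Or.inr ⟨x, h, rfl⟩]
  have hL : (M.restrict s).numLeaves + (M.restrict t).numLeaves ≤ M.numLeaves := by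
    have hd : Disjoint (M.restrict s).leaves (M.restrict t).leaves :=
      Set.disjoint_left.2 fun x hx hx' => Finset.disjoint_left.1 hdisj hx.1 hx'.1
    rw [numLeaves, numLeaves, ← Set.ncard_union_eq hd (finite_leaves _) (finite_leaves _)]
    refine Set.ncard_le_ncard (Set.union_subset ?_ ?_) M.finite_leaves
    · exact fun x hx => ⟨(mem_component.1 hx.1).1, hx.2⟩
    · exact fun x hx => ⟨(mem_component.1 hx.1).1, hx.2⟩
  change ((M.component s).card + 2 * (M.restrict s).numLeaves + 1 - 2 * (M.restrict s).numVertices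
    : ℤ) + ((M.component t).card + 2 * (M.restrict t).numLeaves + 1
      - 2 * (M.restrict t).numVertices) ≤ M.darts.card + 2 * M.numLeaves + 1 - 2 * M.numVertices + 1
  omega

end PlaneMap

/-! ### The cost of one cut-cycle -/

namespace RecNode

open PlaneMap

variable {A V : Type*} [DecidableEq A]

/-- The 9 consists of 2 from the start of the walk, 2 for the vertex that the closing cut may lose,
4 for the two leaves it may create, and 1 for the second constant. -/
theorem IsSplit.potential_le {π : List V} {i : ℕ} {N Nint Next : RecNode A V} (hN : N.M.IsMap)
    (h : IsSplit π i N Nint Next) : Nint.M.IsMap ∧ Next.M.IsMap ∧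
      Nint.M.potential + Next.M.potential ≤ N.M.potential + 9 := by
  obtain ⟨v, M', M'', a₀, b, b', hs, ht, S, -, hslit, -, -, rfl, hsep, hhs, hs', ht', rfl, rfl⟩ := h
  obtain ⟨hM', ha₀, -, hb', -, hcard, hleaves⟩ := hslit.spec hN
  set M'' := M'.splitAt b' a₀ with hM''
  have hmem : ∀ x ∈ M''.darts, M''.σ x ∈ M''.darts := splitAt_sigma_mem hM' hb' ha₀
  have hsl := (mem_component.1 hs').2
  have htl := (mem_component.1 ht').2
  have hst : ¬ Linked M''.σ M''.α N.s N.t := by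
    intro h
    -- `N.t` is linked to the dart `ht`, and the darts are closed under both permutations.
    have h1 : N.t ∈ M''.darts := by
      have hP : ∀ x y, (y = M''.σ x ∨ y = M''.α x) → (x ∈ M''.darts ↔ y ∈ M''.darts) := by
        rintro x y (rfl | rfl)
        exacts [mem_iff_of_mapsTo hmem x, mem_iff_of_mapsTo hM'.alpha_mem x]
      have := eqvGen_lift (R := fun p q : Prop => p ↔ q)
        ⟨fun _ => Iff.rfl, Iff.symm, Iff.trans⟩ (P := fun _ => True) (f := (· ∈ M''.darts))
        (by simp) (fun x y _ => hP x y) htl trivial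
      exact this.2 (mem_component.1 ht').1
    exact hsep (mem_component.2 ⟨h1, h⟩)
  have hcover : ∀ x ∈ M''.darts, x ∈ M''.component N.s ∨ x ∈ M''.component N.t := by
    intro x hx
    -- identify the two corners of the cut to get a connected graph
    let R : A → A → Prop := fun z w => Linked M''.σ M''.α z w ∨
      ((Linked M''.σ M''.α z b' ∨ Linked M''.σ M''.α z a₀) ∧
        (Linked M''.σ M''.α w b' ∨ Linked M''.σ M''.α w a₀))
    have hR : Equivalence R := by
      refine ⟨fun z => Or.inl (Linked.refl z), ?_, ?_⟩
      · rintro z w (h | h)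
        exacts [Or.inl h.symm, Or.inr h.symm]
      · rintro z w u (h | h) (h' | h')
        · exact Or.inl (h.trans h')
        · exact Or.inr ⟨h'.1.imp h.trans h.trans, h'.2⟩
        · exact Or.inr ⟨h.1, h.2.imp h'.symm.trans h'.symm.trans⟩
        · exact Or.inr ⟨h.1, h'.2⟩
    -- `M'` is connected, so after the closing cut every dart is still linked to one of its two
    -- corners; one corner lies on the side of `s`, the other on that of `t`.
    have hxb : R x b' := splitAt_linked hM' hR (fun _ _ h => Or.inl h)
      (Or.inr ⟨Or.inl (Linked.refl _), Or.inr (Linked.refl _)⟩) hx hb'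
    have hx' : Linked M''.σ M''.α x b' ∨ Linked M''.σ M''.α x a₀ := by
      rcases hxb with h | h
      exacts [Or.inl h, h.1]
    simp only [mem_component]
    rcases hhs with ⟨rfl, rfl⟩ | ⟨rfl, rfl⟩ <;> rcases hx' with h | h
    · exact Or.inr ⟨hx, htl.trans h.symm⟩
    · exact Or.inl ⟨hx, hsl.trans h.symm⟩
    · exact Or.inl ⟨hx, hsl.trans h.symm⟩
    · exact Or.inr ⟨hx, htl.trans h.symm⟩
  refine ⟨restrict_isMap hmem hM'.alpha_mem hM'.alpha_alpha hM'.alpha_ne _,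
    restrict_isMap hmem hM'.alpha_mem hM'.alpha_alpha hM'.alpha_ne _, ?_⟩
  refine (potential_restrict_add_le hcover hst).trans ?_
  have h1 : M''.darts.card = M'.darts.card := rfl
  have h2 : M'.numVertices ≤ M''.numVertices + 1 := numVertices_le_splitAt hM' hb' ha₀
  have h3 : M''.numLeaves ≤ M'.numLeaves + 2 := numLeaves_splitAt_le
  have h4 := numLeaves_le hleaves
  unfold PlaneMap.potential
  omega

/-! ### Merging the edges at a vertex of degree two -/

section merge

variable {M : PlaneMap A V} {a : A}

theorem mem_merge {x : A} : x ∈ (merge M a).darts ↔ x ≠ M.σ a ∧ x ≠ a ∧ x ∈ M.darts := by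
  simp [merge]

theorem merge_sigma {x : A} (hx : x ∈ (merge M a).darts) : (merge M a).σ x = M.σ x := by
  rw [mem_merge] at hx
  simp [merge, swap_apply_of_ne_of_ne hx.2.1 hx.1]

theorem alpha_not_mem_pair (hM : M.IsMap) (ha : DegreeTwo M a) :
    M.α a ∈ (merge M a).darts ∧ M.α (M.σ a) ∈ (merge M a).darts := by
  obtain ⟨ha, h1, h2, h3⟩ := ha
  have hb := hM.sigma_mem a ha
  simp only [mem_merge]
  refine ⟨⟨h3, hM.alpha_ne a ha, hM.alpha_mem a ha⟩, hM.alpha_ne _ hb, ?_, hM.alpha_mem _ hb⟩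
  intro h
  have h' := hM.alpha_alpha _ hb
  rw [h] at h'
  exact h3 h'

theorem merge_alpha (hM : M.IsMap) (ha : DegreeTwo M a) :
    (merge M a).α (M.α a) = M.α (M.σ a) ∧ (merge M a).α (M.α (M.σ a)) = M.α a ∧
      ∀ x ∈ (merge M a).darts, x ≠ M.α a → x ≠ M.α (M.σ a) → (merge M a).α x = M.α x := by
  have h := alpha_not_mem_pair hM ha
  simp only [mem_merge] at h
  obtain ⟨⟨h1, h2, -⟩, h3, h4, -⟩ := h
  have hne : M.α a ≠ M.α (M.σ a) := fun h => ha.2.1 (M.α.injective h).symm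
  have hne' := ha.2.1
  refine ⟨?_, ?_, ?_⟩
  · simp only [merge, Perm.mul_apply, swap_apply_def]; grind
  · simp only [merge, Perm.mul_apply, swap_apply_def]; grind
  · intro x hx e1 e2
    rw [mem_merge] at hx
    obtain ⟨e3, e4, -⟩ := hx
    simp only [merge, Perm.mul_apply, swap_apply_def]; grind

theorem merge_isMap (hM : M.IsMap) (ha : DegreeTwo M a) : (merge M a).IsMap := by
  obtain ⟨f1, f2, f3⟩ := merge_alpha hM ha
  obtain ⟨m1, m2⟩ := alpha_not_mem_pair hM ha
  have hne : M.α a ≠ M.α (M.σ a) := fun h => ha.2.1 (M.α.injective h).symm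
  have hb := hM.sigma_mem a ha.1
  have hα : ∀ x ∈ (merge M a).darts, x ≠ M.α a → x ≠ M.α (M.σ a) →
      M.α x ∈ (merge M a).darts := by
    intro x hx e1 e2
    rw [mem_merge] at hx ⊢
    refine ⟨fun h => e2 ?_, fun h => e1 ?_, hM.alpha_mem x hx.2.2⟩
    · rw [← h, hM.alpha_alpha x hx.2.2]
    · rw [← h, hM.alpha_alpha x hx.2.2]
  constructor
  · intro x hx
    rw [merge_sigma hx]
    rw [mem_merge] at hx ⊢
    refine ⟨fun h => hx.2.1 (M.σ.injective h), fun h => hx.1 ?_, hM.sigma_mem x hx.2.2⟩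
    exact M.σ.injective (h.trans ha.2.2.1.symm)
  · intro x hx
    by_cases e1 : x = M.α a
    · rw [e1, f1]; exact m2
    by_cases e2 : x = M.α (M.σ a)
    · rw [e2, f2]; exact m1
    rw [f3 x hx e1 e2]
    exact hα x hx e1 e2
  · intro x hx
    by_cases e1 : x = M.α a
    · rw [e1, f1, f2]
    by_cases e2 : x = M.α (M.σ a)
    · rw [e2, f2, f1]
    have hx' := (mem_merge.1 hx)
    rw [f3 x hx e1 e2, f3 _ (hα x hx e1 e2), hM.alpha_alpha x hx'.2.2]
    · exact fun h => hx'.2.1 (M.α.injective h)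
    · exact fun h => hx'.1 (M.α.injective h)
  · intro x hx
    by_cases e1 : x = M.α a
    · rw [e1, f1]; exact hne.symm
    by_cases e2 : x = M.α (M.σ a)
    · rw [e2, f2]; exact hne
    rw [f3 x hx e1 e2]
    exact hM.alpha_ne x (mem_merge.1 hx).2.2
  · have lab : Linked (merge M a).σ (merge M a).α (M.α a) (M.α (M.σ a)) := by
      have := Linked.right (σ := (merge M a).σ) (α := (merge M a).α) (M.α a)
      rwa [f1] at this
    -- Retraction onto the remaining darts: either removed dart goes to the other end of its edge,
    -- and these two ends are joined by the merged edge.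
    let f : A → A := fun x => if x = a then M.α a else if x = M.σ a then M.α (M.σ a) else x
    have fa : f a = M.α a := by simp [f]
    have fb : f (M.σ a) = M.α (M.σ a) := by simp [f, ha.2.1]
    have fx : ∀ x ∈ (merge M a).darts, f x = x := fun x hx => by
      rw [mem_merge] at hx
      simp [f, hx.1, hx.2.1]
    intro x hx y hy
    rw [← fx x hx, ← fx y hy]
    refine hM.lift Linked.equivalence ?_ ?_ (mem_merge.1 hx).2.2 (mem_merge.1 hy).2.2
    · intro x hx
      by_cases e1 : x = a
      · rw [e1, fa, fb]; exact lab
      by_cases e2 : x = M.σ a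
      · rw [e2, ha.2.2.1, fa, fb]; exact lab.symm
      have hx' := mem_merge.2 ⟨e2, e1, hx⟩
      have h := Linked.left (σ := (merge M a).σ) (α := (merge M a).α) x
      rw [merge_sigma hx'] at h
      rwa [fx x hx', fx (M.σ x)]
      refine mem_merge.2 ⟨fun h => e1 (M.σ.injective h), fun h => e2 ?_, hM.sigma_mem x hx⟩
      exact M.σ.injective (h.trans ha.2.2.1.symm)
    · intro x hx
      by_cases e1 : x = a
      · rw [e1, fa, fx _ m1]; exact Linked.refl _
      by_cases e2 : x = M.σ a
      · rw [e2, fb, fx _ m2]; exact Linked.refl _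
      have hx' := mem_merge.2 ⟨e2, e1, hx⟩
      by_cases e3 : x = M.α a
      · rw [e3, fx _ m1, hM.alpha_alpha a ha.1, fa]; exact Linked.refl _
      by_cases e4 : x = M.α (M.σ a)
      · rw [e4, fx _ m2, hM.alpha_alpha _ hb, fb]; exact Linked.refl _
      have h := Linked.right (σ := (merge M a).σ) (α := (merge M a).α) x
      rw [f3 x hx' e3 e4] at h
      rwa [fx x hx', fx _ (hα x hx' e3 e4)]

/-- The old orbits other than that of `a` survive, so the loss of two darts compensates for the loss
of at most one vertex. -/
theorem merge_potential_le (hM : M.IsMap) (ha : DegreeTwo M a) :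
    (merge M a).potential ≤ M.potential := by
  have hM' := merge_isMap hM ha
  have hb := hM.sigma_mem a ha.1
  have hcard : (merge M a).darts.card + 2 = M.darts.card := by
    have h1 : M.σ a ∈ M.darts.erase a := Finset.mem_erase.2 ⟨ha.2.1, hb⟩
    have h2 := Finset.card_erase_add_one h1
    have h3 := Finset.card_erase_add_one ha.1
    simp only [merge]
    omega
  have hL : (merge M a).numLeaves ≤ M.numLeaves := numLeaves_le fun x hx =>
    ⟨(mem_merge.1 hx.1).2.2, (merge_sigma hx.1).symm.trans hx.2⟩
  have hV : M.numVertices ≤ (merge M a).numVertices + 1 := by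
    have key := ncard_image_le_numVertices (merge M a) hM'.sigma_mem M.orb (fun x hx => by
      rw [merge_sigma hx, orb_sigma])
    have h1 := Set.ncard_le_ncard_sdiff_add_ncard (M.orb '' (M.darts : Set A)) {M.orb a}
    rw [Set.ncard_singleton, ← numVertices_eq] at h1
    refine h1.trans (Nat.succ_le_succ (le_trans (Set.ncard_le_ncard ?_
      ((Finset.finite_toSet _).image _)) key))
    rintro _ ⟨⟨x, hx, rfl⟩, hxa⟩
    refine ⟨x, mem_merge.2 ⟨?_, ?_, hx⟩, rfl⟩
    · rintro rfl; exact hxa (orb_sigma M a)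
    · rintro rfl; exact hxa rfl
  unfold PlaneMap.potential
  omega

end merge

/-! ### Reduced maps and the induction over the recursion tree -/

theorem Reduces.potential_le {N N' : RecNode A V} (h : N.Reduces N') (hN : N.M.IsMap) :
    N'.M.IsMap ∧ N'.M.potential ≤ N.M.potential := by
  obtain ⟨h, -⟩ := h
  induction h with
  | refl => exact ⟨hN, le_rfl⟩
  | tail _ hstep ih =>
    cases hstep with
    | moveS => exact ih
    | moveT => exact ih
    | merge M s t a ha =>
      exact ⟨merge_isMap ih.1 ha, (merge_potential_le ih.1 ha).trans ih.2⟩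

theorem numVertices_le_potential {M : PlaneMap A V} (hM : M.IsMap) (h : ∀ a, ¬ DegreeTwo M a) :
    (M.numVertices : ℤ) ≤ M.potential := by
  classical
  suffices 3 * M.numVertices ≤ M.darts.card + 2 * M.numLeaves + 1 by
    unfold PlaneMap.potential
    omega
  by_cases hloop : ∃ a ∈ M.darts, M.σ a ≠ a ∧ M.σ (M.σ a) = a
  · obtain ⟨a, ha, h1, h2⟩ := hloop
    have h3 : M.α a = M.σ a := by
      by_contra h3
      exact h a ⟨ha, h1, h2, h3⟩
    have h4 : M.α (M.σ a) = a := by rw [← h3, hM.alpha_alpha a ha]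
    -- The pair `a`, `M.σ a` is closed under both permutations, so by connectedness it is the whole
    -- map: one vertex with a loop, where the inequality reads `3 ≤ 2 + 1`.
    have hall : ∀ x ∈ M.darts, M.orb a = M.orb x := by
      intro x hx
      have hx' : a = x ∨ M.σ a = x := by
        have := hM.lift (R := fun p q : Prop => p ↔ q) ⟨fun _ => Iff.rfl, Iff.symm, Iff.trans⟩
          (f := fun y => a = y ∨ M.σ a = y) (fun y hy => ?_) (fun y hy => ?_) ha hx
        · exact this.1 (Or.inl rfl)
        · constructor
          · rintro (rfl | rfl)
            exacts [Or.inr rfl, Or.inl h2.symm]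
          · rintro (e | e)
            · exact Or.inr (M.σ.injective (h2.trans e))
            · exact Or.inl (M.σ.injective e)
        · constructor
          · rintro (rfl | rfl)
            exacts [Or.inr h3.symm, Or.inl h4.symm]
          · rintro (e | e)
            · exact Or.inr (M.α.injective (h4.trans e))
            · exact Or.inl (M.α.injective (h3.trans e))
      rcases hx' with rfl | rfl
      exacts [rfl, (orb_sigma M a).symm]
    have hV : M.numVertices ≤ 1 := by
      rw [numVertices_eq, ← Set.ncard_singleton (M.orb a)]
      refine Set.ncard_le_ncard ?_
      rintro _ ⟨x, hx, rfl⟩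
      exact (hall x hx).symm
    have hD : 2 ≤ M.darts.card := by
      rw [← Finset.card_pair h1.symm]
      refine Finset.card_le_card fun x hx => ?_
      rw [Finset.mem_insert, Finset.mem_singleton] at hx
      rcases hx with rfl | rfl
      exacts [ha, hM.sigma_mem a ha]
    omega
  · push Not at hloop
    have hV : M.numVertices = (M.darts.image M.orb).card := by
      rw [numVertices_eq, ← Finset.coe_image, Set.ncard_coe_finset]
    have hL : M.numLeaves = ∑ x ∈ M.darts, if M.σ x = x then 1 else 0 := by
      rw [Finset.sum_boole, Nat.cast_id, ← Set.ncard_coe_finset, Finset.coe_filter]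
      rfl
    -- A leaf has the weight `1 + 2`; any other vertex has at least three darts, since degree two is
    -- excluded.
    have hfib : ∀ o ∈ M.darts.image M.orb, 3 ≤
        ∑ x ∈ M.darts with M.orb x = o, (1 + 2 * if M.σ x = x then 1 else 0) := by
      intro o ho
      obtain ⟨a, ha, rfl⟩ := Finset.mem_image.1 ho
      by_cases h1 : M.σ a = a
      · refine le_trans ?_ (Finset.single_le_sum
          (f := fun x => 1 + 2 * if M.σ x = x then 1 else 0) (fun _ _ => Nat.zero_le _)
          (Finset.mem_filter.2 ⟨ha, rfl⟩))
        simp [h1]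
      · have h2 := hloop a ha h1
        have h3 : M.σ (M.σ a) ≠ M.σ a := fun h => h1 (M.σ.injective h)
        have hcard : ({a, M.σ a, M.σ (M.σ a)} : Finset A).card = 3 :=
          Finset.card_eq_three.2 ⟨_, _, _, fun h => h1 h.symm, fun h => h2 h.symm,
            fun h => h3 h.symm, rfl⟩
        have hb := hM.sigma_mem a ha
        refine le_trans (hcard.symm.le.trans (Finset.card_le_card (t := {x ∈ M.darts |
          M.orb x = M.orb a}) ?_)) ?_
        · intro x hx
          simp only [Finset.mem_insert, Finset.mem_singleton] at hx
          rw [Finset.mem_filter]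
          rcases hx with rfl | rfl | rfl
          · exact ⟨ha, rfl⟩
          · exact ⟨hb, orb_sigma M a⟩
          · exact ⟨hM.sigma_mem _ hb, (orb_sigma M _).trans (orb_sigma M a)⟩
        · rw [Finset.card_eq_sum_ones]
          exact Finset.sum_le_sum fun _ _ => Nat.le_add_right _ _
    have h1 := Finset.card_nsmul_le_sum _ _ 3 hfib
    rw [Finset.sum_fiberwise_of_maps_to (fun x hx => Finset.mem_image_of_mem _ hx),
      Finset.sum_add_distrib, ← Finset.mul_sum, ← hL, ← hV, ← Finset.card_eq_sum_ones,
      smul_eq_mul] at h1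
    omega

end RecNode

/-- The index ranges of the two calls have total length `hi - lo - 1`; the index used up pays the 9
of the split. A call that ended above the level contributes nothing, which is harmless because its
reduced potential is nonnegative. -/
theorem RecursionTree.levelVertices_le {A V : Type*} [DecidableEq A] {π : List V}
    {N : RecNode A V} {lo hi : ℕ} (T : RecursionTree π N lo hi) (hN : N.M.IsMap) (l : ℕ) :
    (T.levelVertices l : ℤ) ≤ N.M.potential + 9 * (hi - lo : ℕ) := by
  induction T generalizing l with
  | halt N' h =>
    have h1 := h.potential_le hN
    have h2 := RecNode.numVertices_le_potential h1.1 h.2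
    cases l with
    | zero => simp only [levelVertices]; omega
    | succ l => simp only [levelVertices]; omega
  | recurse N' Nint Next i h hlo hhi hsplit Tint Text ihint ihext =>
    have h1 := h.potential_le hN
    cases l with
    | zero =>
      have h2 := RecNode.numVertices_le_potential h1.1 h.2
      simp only [levelVertices]; omega
    | succ l =>
      obtain ⟨hint, hext, hle⟩ := hsplit.potential_le h1.1
      have h2 := ihint hint l
      have h3 := ihext hext l
      simp only [levelVertices]
      push_cast
      omega

/-! ### First-return permutations -/

section nextSame

variable {D K : Type*} [Finite D] (f : Perm D) (c : D → K)

theorem color_nextSame (d : D) : c (nextSame f c d) = c d := by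
  obtain ⟨k, hk, hc, -⟩ := nextSameFun_spec f c d
  change c (nextSameFun f c d) = c d
  rw [hk, hc]

theorem sameCycle_nextSame_apply (d : D) : f.SameCycle d (nextSame f c d) := by
  obtain ⟨k, hk, -⟩ := nextSameFun_spec f c d
  refine ⟨((k + 1 : ℕ) : ℤ), ?_⟩
  rw [zpow_natCast]
  change _ = nextSameFun f c d
  rw [hk, Perm.iterate_eq_pow]

/-- The first return cannot jump past `y`, which has the right colour, so repeated returns from `x`
reach it. -/
theorem nextSame_sameCycle {x y : D} (h : f.SameCycle x y) (hc : c x = c y) :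
    (nextSame f c).SameCycle x y := by
  obtain ⟨n, hn⟩ : ∃ n : ℕ, f^[n] x = y := by
    obtain ⟨n, -, hn⟩ := h.exists_pow_eq'
    exact ⟨n, by rw [Perm.iterate_eq_pow, hn]⟩
  clear h
  induction n using Nat.strong_induction_on generalizing x with
  | _ n ih =>
    rcases Nat.eq_zero_or_pos n with rfl | hpos
    · exact hn ▸ Perm.SameCycle.refl _ _
    · obtain ⟨k, hk, hck, hmin⟩ := nextSameFun_spec f c x
      have hkn : k + 1 ≤ n := by
        by_contra hlt
        apply hmin (n - 1) (by omega)
        rw [Nat.sub_add_cancel hpos, hn, hc]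
      rw [← Perm.sameCycle_apply_left]
      refine ih (n - (k + 1)) (by omega) ((color_nextSame f c x).trans hc) ?_
      change f^[n - (k + 1)] (nextSameFun f c x) = y
      rw [hk, ← Function.iterate_add_apply, Nat.sub_add_cancel hkn, hn]

end nextSame

/-! ### Border vertices and the connectedness of the contracted graph -/

namespace PlaneGraph

variable {V D K : Type*} [Fintype V] [Fintype D] {G : PlaneGraph V D} {cl : D → K}

theorem vtx_sigma (d : D) : G.vtx (G.σ d) = G.vtx d :=
  (G.vtx_eq_iff _ _).2 (Perm.SameCycle.refl _ _).apply_left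

theorem exit_nextExit {d : D} : G.Exit cl (G.nextExit cl d) ↔ G.Exit cl d :=
  iff_of_eq (color_nextSame (G.clusterFace cl) (G.Exit cl) d)

theorem proper_nextExit {d : D} : G.Proper cl (G.nextExit cl d) ↔ G.Proper cl d := by
  simp only [Proper, exit_nextExit, ne_eq, EmbeddingLike.apply_eq_iff_eq]

theorem vtx_arrive (d : D) : G.vtx (G.arrive cl d) = G.vtx (G.nextExit cl d) := by
  rw [G.vtx_eq_iff]
  have := sameCycle_nextSame_apply G.σ (G.Exit cl) (G.arrive cl d)
  simpa [arrive] using this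

theorem Exit.isBorder {d : D} (h : G.Exit cl d) : G.IsBorder cl (cl d) (G.vtx d) :=
  ⟨⟨d, rfl, rfl⟩, cl (G.σ d), h, ⟨G.σ d, vtx_sigma d, rfl⟩⟩

/-- A border vertex of a cluster has an exit corner of this cluster. -/
theorem IsBorder.exists_exit {p : K} {v : V} (h : G.IsBorder cl p v) :
    ∃ d, G.Exit cl d ∧ cl d = p ∧ G.vtx d = v := by
  classical
  obtain ⟨⟨d, hd, hdp⟩, q, hq, e, he, heq⟩ := h
  by_contra hno
  push Not at hno
  -- Without an exit corner the darts of `p` at `v` would be closed under the rotation, and so would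
  -- be all the darts at `v`.
  let s : Finset D := Finset.univ.filter fun x => G.vtx x = v ∧ cl x = p
  have hs : ∀ x ∈ s, G.σ x ∈ s := by
    intro x hx
    simp only [s, Finset.mem_filter, Finset.mem_univ, true_and] at hx ⊢
    refine ⟨(vtx_sigma x).trans hx.1, ?_⟩
    by_contra hne
    exact hno x (fun h => hne (h.trans hx.2)) hx.2 hx.1
  have hde : G.σ.SameCycle d e := (G.vtx_eq_iff d e).1 (hd.trans he.symm)
  have := hde.lift (R := fun p q : Prop => p ↔ q) ⟨fun _ => Iff.rfl, Iff.symm, Iff.trans⟩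
    (P := fun _ => True) (f := (· ∈ s)) (by simp) (fun x _ => mem_iff_of_mapsTo hs x) trivial
  have hes : e ∈ s := this.1 (by simp [s, hd, hdp])
  simp only [s, Finset.mem_filter, Finset.mem_univ, true_and] at hes
  exact hq (heq.symm.trans hes.2)

section contracted

variable {hcl : ∀ d, cl (G.α d) = cl d} {ps pt : K}

theorem mem_contracted {x : (D × Fin 4) ⊕ ℕ} :
    x ∈ (G.contracted cl hcl ps pt).darts ↔ ∃ z, G.Active cl ps pt z ∧ Sum.inl z = x := by
  simp [contracted]

theorem contracted_alpha (z : D × Fin 4) : (G.contracted cl hcl ps pt).α (Sum.inl z) =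
    Sum.inl (G.reverseFun cl ps pt z) := rfl

theorem active_reverse (hcl : ∀ d, cl (G.α d) = cl d) {z : D × Fin 4}
    (h : G.Active cl ps pt z) : G.Active cl ps pt (G.reverseFun cl ps pt z) := by
  obtain ⟨d, k⟩ := z
  fin_cases k
  · by_cases he : cl d = ps ∨ cl d = pt
    · simp [reverseFun, he, hcl, Active]
    · simpa [reverseFun, he, Active] using h
  · simpa [reverseFun, Active] using h
  · simpa [reverseFun, Active] using h
  · simp only [Active] at h
    simp [reverseFun, h.1, h.2, Active]

theorem reverse_ne {z : D × Fin 4} (h : G.Active cl ps pt z) : G.reverseFun cl ps pt z ≠ z := by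
  obtain ⟨d, k⟩ := z
  fin_cases k
  · by_cases he : cl d = ps ∨ cl d = pt
    · simp [reverseFun, he, G.α_ne]
    · simp [reverseFun, he]
  · simp [reverseFun]
  · simp [reverseFun]
  · simp only [Active] at h
    simp [reverseFun, h.1]

/-- The darts `x` and `y` are in the same component of the contracted graph. -/
def CLinked (G : PlaneGraph V D) (cl : D → K) (hcl : ∀ d, cl (G.α d) = cl d) (ps pt : K)
    (x y : D × Fin 4) : Prop :=
  Linked (G.contracted cl hcl ps pt).σ (G.contracted cl hcl ps pt).α (Sum.inl x) (Sum.inl y)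

theorem cLinked_of_sameCycle {x y : D × Fin 4} (hx : G.Active cl ps pt x)
    (hy : G.Active cl ps pt y) (h : (G.fullRotation cl).SameCycle x y) :
    G.CLinked cl hcl ps pt x y := by
  have h' := nextSame_sameCycle _ (G.Active cl ps pt) h (propext (iff_of_true hx hy))
  exact h'.lift Linked.equivalence (P := fun _ => True) (f := Sum.inl) (by simp)
    (fun z _ => Linked.left _) trivial

theorem fullRotation_sameCycle_zero (d : D) {i : Fin 4} (hi : i ≠ 3) :
    (G.fullRotation cl).SameCycle (d, 0) (d, i) := by
  have h1 : (G.fullRotation cl).SameCycle (d, 0) (d, 1) := ⟨1, rfl⟩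
  have h2 : (G.fullRotation cl).SameCycle (d, 1) (d, 2) := ⟨1, rfl⟩
  fin_cases i
  · exact Perm.SameCycle.refl _ _
  · exact h1
  · exact h1.trans h2
  · exact absurd rfl hi

theorem fullRotation_sameCycle {d e : D} (h : G.vtx d = G.vtx e) {i j : Fin 4} (hi : i ≠ 3)
    (hj : j ≠ 3) : (G.fullRotation cl).SameCycle (d, i) (e, j) := by
  refine (fullRotation_sameCycle_zero d hi).symm.trans
    (Perm.SameCycle.trans ?_ (fullRotation_sameCycle_zero e hj))
  refine ((G.vtx_eq_iff d e).1 h).lift (R := (G.fullRotation cl).SameCycle)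
    ⟨Perm.SameCycle.refl _, Perm.SameCycle.symm, Perm.SameCycle.trans⟩ (P := fun _ => True)
    (f := fun d => (d, (0 : Fin 4))) (by simp) (fun x _ => ?_) trivial
  exact (fullRotation_sameCycle_zero x (i := 2) (by decide)).trans ⟨1, rfl⟩

theorem cLinked_of_vtx {d e : D} (h : G.vtx d = G.vtx e) {i j : Fin 4} (hi : i ≠ 3)
    (hj : j ≠ 3) (hd : G.Active cl ps pt (d, i)) (he : G.Active cl ps pt (e, j)) :
    G.CLinked cl hcl ps pt (d, i) (e, j) :=
  cLinked_of_sameCycle hd he (fullRotation_sameCycle h hi hj)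

theorem cLinked_nextExit {d : D} (h : G.Proper cl d) :
    G.CLinked cl hcl ps pt (d, 1) (G.nextExit cl d, 1) := by
  have h1 : G.CLinked cl hcl ps pt (d, 1) (G.arrive cl d, 2) := Linked.right _
  refine Linked.trans h1 (cLinked_of_vtx (vtx_arrive d) (by decide) (by decide) ?_ ?_)
  · simpa [Active] using h
  · exact proper_nextExit.2 h

/-- The skeleton edges of a cluster connect its border vertices. -/
theorem cLinked_of_exit (hole : ∀ d e, G.Exit cl d → G.Exit cl e → cl d = cl e →
    (G.clusterFace cl).SameCycle d e) {d e : D} (hd : G.Exit cl d) (he : G.Exit cl e)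
    (hde : cl d = cl e) : d = e ∨
      (G.Proper cl d ∧ G.Proper cl e ∧ G.CLinked cl hcl ps pt (d, 1) (e, 1)) := by
  -- With one hole, all exit corners of the cluster form a single cycle of `nextExit`; a fixed point
  -- is then the only exit.
  have h : (G.nextExit cl).SameCycle d e :=
    nextSame_sameCycle _ _ (hole d e hd he hde) (propext (iff_of_true hd he))
  by_cases hp : G.Proper cl d
  · refine Or.inr ⟨hp, ?_, ?_⟩
    · exact (h.lift (R := fun p q : Prop => p ↔ q) ⟨fun _ => Iff.rfl, Iff.symm, Iff.trans⟩
        (P := fun _ => True) (f := G.Proper cl) (by simp)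
        (fun x _ => proper_nextExit.symm) trivial).1 hp
    · exact h.lift Linked.equivalence (P := G.Proper cl) (f := fun d => Sum.inl (d, (1 : Fin 4)))
        (fun x => proper_nextExit.symm) (fun x hx => cLinked_nextExit hx) hp
  · left
    have hfix : G.nextExit cl d = d := by
      by_contra hne
      exact hp ⟨hd, hne⟩
    exact h.eq_of_left hfix

/-- Connectedness is inherited from `G` by walking through its darts. Inside an explicit cluster the
walk itself is available; in any other cluster the cycle of skeleton edges replaces it, and star
centres hang on border vertices. -/
theorem contracted_linked (hole : ∀ d e, G.Exit cl d → G.Exit cl e → cl d = cl e →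
    (G.clusterFace cl).SameCycle d e) (hps : ∃ d, cl d = ps) :
    ∃ x, ∀ y, G.Active cl ps pt y → G.CLinked cl hcl ps pt x y := by
  classical
  -- The base dart sits at an exit corner whenever `ps` has one, so that the skeleton cycle of `ps`
  -- can be reached from it directly.
  obtain ⟨d₀, hd₀, hexit⟩ : ∃ d₀, cl d₀ = ps ∧ ∀ e, G.Exit cl e → cl e = ps → G.Exit cl d₀ := by
    by_cases h : ∃ d, cl d = ps ∧ G.Exit cl d
    · obtain ⟨d, h1, h2⟩ := h
      exact ⟨d, h1, fun _ _ _ => h2⟩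
    · obtain ⟨d, hd⟩ := hps
      exact ⟨d, hd, fun e he hep => (h ⟨e, hep, he⟩).elim⟩
  have hact₀ : G.Active cl ps pt (d₀, 0) := Or.inl (Or.inl hd₀)
  refine ⟨(d₀, 0), ?_⟩
  let C : D × Fin 4 → Prop := G.CLinked cl hcl ps pt (d₀, 0)
  -- The property carried along the walk in `G`: `d` itself is reached if it is explicit, and so is
  -- everything at the border vertices of its cluster. The second half depends only on the cluster
  -- of `d`.
  let B : D → Prop := fun d => ((cl d = ps ∨ cl d = pt) → C (d, 0)) ∧
    ∀ e, G.Exit cl e → cl e = cl d → ∀ f i, i ≠ 3 → G.vtx e = G.vtx f →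
      G.Active cl ps pt (f, i) → C (f, i)
  have hB₀ : B d₀ := by
    refine ⟨fun _ => Linked.refl _, fun e he hed f i hi hf hact => ?_⟩
    have hd := hexit e he (hed.trans hd₀)
    rcases cLinked_of_exit (hcl := hcl) (ps := ps) (pt := pt) hole hd he hed.symm with
      rfl | ⟨hp, hp', hl⟩
    · exact cLinked_of_vtx hf (by decide) hi hact₀ hact
    · exact (cLinked_of_vtx (j := 1) rfl (by decide) (by decide) hact₀ hp).trans
        (hl.trans (cLinked_of_vtx hf (by decide) hi hp' hact))
  have hBα : ∀ d, B d → B (G.α d) := by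
    rintro d ⟨h1, h2⟩
    refine ⟨fun he => ?_, fun e he hed => h2 e he (hed.trans (hcl d))⟩
    rw [hcl] at he
    refine (h1 he).trans ?_
    have := Linked.right (σ := (G.contracted cl hcl ps pt).σ)
      (α := (G.contracted cl hcl ps pt).α) (Sum.inl (d, 0))
    rw [contracted_alpha] at this
    simpa only [reverseFun, if_pos he] using this
  have hBσ : ∀ d, B d → B (G.σ d) := by
    rintro d ⟨h1, h2⟩
    by_cases hd : cl (G.σ d) = cl d
    · refine ⟨fun he => ?_, fun e he hed => h2 e he (hed.trans hd)⟩
      have he' := he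
      rw [hd] at he'
      exact (h1 he').trans (cLinked_of_vtx (vtx_sigma d).symm (by decide) (by decide)
        (Or.inl he') (Or.inl he))
    -- The walk changes clusters here, at a border vertex of both. The new cluster has an exit
    -- corner at this vertex too, and its skeleton cycle leads to its other border vertices.
    · have hv := h2 d hd rfl
      refine ⟨fun he => hv _ _ (by decide) (vtx_sigma d).symm (Or.inl he),
        fun e he hed f i hi hf hact => ?_⟩
      obtain ⟨e', he', hed', hev'⟩ := IsBorder.exists_exit (G := G) (cl := cl) (p := cl (G.σ d))
        (v := G.vtx d) ⟨⟨_, vtx_sigma d, rfl⟩, cl d, fun h => hd h.symm, ⟨d, rfl, rfl⟩⟩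
      rcases cLinked_of_exit (hcl := hcl) (ps := ps) (pt := pt) hole he' he (hed'.trans hed.symm)
        with rfl | ⟨hp, hp', hl⟩
      · exact hv f i hi (hev'.symm.trans hf) hact
      · exact (hv e' 1 (by decide) hev'.symm hp).trans
          (hl.trans (cLinked_of_vtx hf (by decide) hi hp' hact))
  have hB : ∀ d, B d := by
    intro d
    let s : Finset D := Finset.univ.filter B
    have hs : ∀ x, x ∈ s ↔ B x := by simp [s]
    have hσ := mem_iff_of_mapsTo (f := G.σ) (s := s) fun x hx => (hs _).2 (hBσ x ((hs x).1 hx))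
    have hα := mem_iff_of_mapsTo (f := G.α) (s := s) fun x hx => (hs _).2 (hBα x ((hs x).1 hx))
    have := eqvGen_lift (R := fun p q : Prop => p ↔ q) ⟨fun _ => Iff.rfl, Iff.symm, Iff.trans⟩
      (P := fun _ => True) (f := (· ∈ s)) (by simp) (fun x y _ hxy => by
        rcases hxy with rfl | rfl
        exacts [hσ x, hα x]) (Linked.mem_orbit_iff.1 (G.connected d₀ d)) trivial
    exact (hs d).1 (this.1 ((hs d₀).2 hB₀))
  have h0 : ∀ d, G.Active cl ps pt (d, 0) → C (d, 0) := by
    intro d hact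
    rcases hact with he | hp
    · exact (hB d).1 he
    · exact (hB d).2 d hp.1 rfl d 0 (by decide) rfl (Or.inr hp)
  rintro ⟨d, k⟩ hact
  match k, hact with
  | 0, hact => exact h0 d hact
  | 1, hact => exact (hB d).2 d (And.left hact) rfl d 1 (by decide) rfl hact
  | 2, hact =>
    have hp : G.Proper cl ((G.arrive cl)⁻¹ d) := hact
    have hv := vtx_arrive (G := G) (cl := cl) ((G.arrive cl)⁻¹ d)
    rw [show G.arrive cl ((G.arrive cl)⁻¹ d) = d by simp] at hv
    exact (hB _).2 _ (proper_nextExit.2 hp).1 rfl d 2 (by decide) hv.symm hact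
  | 3, hact =>
    obtain ⟨he, hp⟩ : ¬ (cl d = ps ∨ cl d = pt) ∧ G.Proper cl d := hact
    refine (h0 d (Or.inr hp)).trans ?_
    have := Linked.right (σ := (G.contracted cl hcl ps pt).σ)
      (α := (G.contracted cl hcl ps pt).α) (Sum.inl (d, 0))
    rw [contracted_alpha] at this
    simpa only [reverseFun, if_neg he] using this

theorem contracted_isMap (hole : ∀ d e, G.Exit cl d → G.Exit cl e → cl d = cl e →
    (G.clusterFace cl).SameCycle d e) (hps : ∃ d, cl d = ps) :
    (G.contracted cl hcl ps pt).IsMap := by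
  constructor
  · intro x hx
    obtain ⟨z, hz, rfl⟩ := mem_contracted.1 hx
    refine mem_contracted.2 ⟨_, ?_, rfl⟩
    exact (iff_of_eq (color_nextSame (G.fullRotation cl) (G.Active cl ps pt) z)).2 hz
  · intro x hx
    obtain ⟨z, hz, rfl⟩ := mem_contracted.1 hx
    exact mem_contracted.2 ⟨_, active_reverse hcl hz, rfl⟩
  · intro x hx
    obtain ⟨z, hz, rfl⟩ := mem_contracted.1 hx
    rw [contracted_alpha, contracted_alpha, G.reverseFun_involutive cl ps pt hcl z]
  · intro x hx
    obtain ⟨z, hz, rfl⟩ := mem_contracted.1 hx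
    rw [contracted_alpha]
    exact fun h => reverse_ne hz (Sum.inl_injective h)
  · intro x hx y hy
    obtain ⟨z, hz, rfl⟩ := mem_contracted.1 hx
    obtain ⟨w, hw, rfl⟩ := mem_contracted.1 hy
    obtain ⟨u, hu⟩ := contracted_linked (hcl := hcl) (pt := pt) hole hps
    exact (hu z hz).symm.trans (hu w hw)

end contracted

/-! ### Size of the root and length of the path -/

section counting

variable [Fintype K]

/-- The total number of border vertices of the clusters. -/
noncomputable def totalBorder (G : PlaneGraph V D) (cl : D → K) : ℕ :=
  ∑ p, Set.ncard {v | G.IsBorder cl p v}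

theorem card_filter_le_of_vtx (hdeg : ∀ v, Set.ncard {d | G.vtx d = v} ≤ 3) {P : D → Prop}
    [DecidablePred P] {Q : V → Prop} (h : ∀ d, P d → Q (G.vtx d)) :
    (Finset.univ.filter P).card ≤ 3 * Set.ncard {v | Q v} := by
  classical
  refine (Finset.card_le_mul_card_image (f := G.vtx) _ 3 fun v _ => ?_).trans
    (Nat.mul_le_mul_left 3 ?_)
  · refine le_trans ?_ (hdeg v)
    rw [← Set.ncard_coe_finset]
    exact Set.ncard_le_ncard fun d hd => (Finset.mem_filter.1 hd).2
  · rw [← Set.ncard_coe_finset]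
    refine Set.ncard_le_ncard fun v hv => ?_
    obtain ⟨d, hd, rfl⟩ := Finset.mem_image.1 hv
    exact h d (Finset.mem_filter.1 hd).2

open Classical in
theorem card_exit_le (hdeg : ∀ v, Set.ncard {d | G.vtx d = v} ≤ 3) :
    (Finset.univ.filter (G.Exit cl)).card ≤ 3 * G.totalBorder cl := by
  rw [totalBorder, Finset.mul_sum,
    Finset.card_eq_sum_card_fiberwise (f := cl) (t := Finset.univ) (fun _ _ => Finset.mem_univ _)]
  refine Finset.sum_le_sum fun p _ => ?_
  rw [Finset.filter_filter]
  refine card_filter_le_of_vtx hdeg ?_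
  rintro d ⟨h, rfl⟩
  exact h.isBorder

/-- By the degree bound, either explicit cluster has at most `3 * r` darts, and there are at most `3
* totalBorder` proper exit corners; each of these accounts for at most one dart of each of the four
kinds. -/
theorem card_contracted_le (hdeg : ∀ v, Set.ncard {d | G.vtx d = v} ≤ 3) {r : ℕ}
    (hr : ∀ p, Set.ncard {v | G.InCluster cl p v} ≤ r) (hcl : ∀ d, cl (G.α d) = cl d) (ps pt : K) :
    (G.contracted cl hcl ps pt).darts.card ≤ 6 * r + 12 * G.totalBorder cl := by
  classical
  let E : K → Finset D := fun p => Finset.univ.filter fun d => cl d = p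
  let P : Finset D := Finset.univ.filter (G.Proper cl)
  have hE : ∀ p, (E p).card ≤ 3 * r := fun p =>
    (card_filter_le_of_vtx hdeg (Q := G.InCluster cl p) fun d hd => ⟨d, rfl, hd⟩).trans
      (Nat.mul_le_mul_left 3 (hr p))
  have hP : P.card ≤ 3 * G.totalBorder cl :=
    (Finset.card_le_card (Finset.monotone_filter_right _ fun d _ h => h.1)).trans (card_exit_le hdeg)
  have hmem : ∀ d, d ∈ P ↔ G.Proper cl d := by simp [P]
  have hsub : Finset.univ.filter (G.Active cl ps pt) ⊆
      (((E ps ∪ E pt) ∪ P).image (fun d => (d, (0 : Fin 4)))) ∪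
      (P.image (fun d => (d, (1 : Fin 4))) ∪ (P.image (fun d => (G.arrive cl d, (2 : Fin 4))) ∪
        P.image (fun d => (d, (3 : Fin 4))))) := by
    rintro ⟨d, k⟩ h
    have hact := (Finset.mem_filter.1 h).2
    simp only [Finset.mem_union, Finset.mem_image]
    match k, hact with
    | 0, hact =>
      refine Or.inl ⟨d, ?_, rfl⟩
      simp only [E, P, Finset.mem_filter, Finset.mem_univ, true_and]
      exact hact
    | 1, hact => exact Or.inr (Or.inl ⟨d, (hmem d).2 hact, rfl⟩)
    | 2, hact => exact Or.inr (Or.inr (Or.inl ⟨(G.arrive cl)⁻¹ d, (hmem _).2 hact, by simp⟩))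
    | 3, hact => exact Or.inr (Or.inr (Or.inr ⟨d, (hmem d).2 (And.right hact), rfl⟩))
  have h1 : (G.contracted cl hcl ps pt).darts.card =
    (Finset.univ.filter (G.Active cl ps pt)).card := Finset.card_map _
  rw [h1]
  refine (Finset.card_le_card hsub).trans ?_
  refine (Finset.card_union_le _ _).trans ?_
  have h2 := (Finset.card_image_le (s := (E ps ∪ E pt) ∪ P) (f := fun d => (d, (0 : Fin 4)))).trans
    ((Finset.card_union_le _ _).trans (Nat.add_le_add_right (Finset.card_union_le _ _) _))
  have h3 := Finset.card_union_le (P.image (fun d => (d, (1 : Fin 4))))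
    (P.image (fun d => (G.arrive cl d, (2 : Fin 4))) ∪ P.image (fun d => (d, (3 : Fin 4))))
  have h4 := Finset.card_union_le (P.image (fun d => (G.arrive cl d, (2 : Fin 4))))
    (P.image (fun d => (d, (3 : Fin 4))))
  have h5 := Finset.card_image_le (s := P) (f := fun d => (d, (1 : Fin 4)))
  have h6 := Finset.card_image_le (s := P) (f := fun d => (G.arrive cl d, (2 : Fin 4)))
  have h7 := Finset.card_image_le (s := P) (f := fun d => (d, (3 : Fin 4)))
  have h8 := hE ps
  have h9 := hE pt
  omega

theorem IsSimplePath.length_le {adj : V → V → Prop} {u v : V} {p : List V}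
    (h : IsSimplePath adj u v p) {Q : V → Prop} (hu : Q u) (hadj : ∀ x y, adj x y → Q y) :
    p.length ≤ Set.ncard {w | Q w} := by
  classical
  obtain ⟨hhead, -, hnodup, hchain⟩ := h
  have hQ : ∀ w ∈ p, Q w := by
    clear hnodup
    induction p generalizing u with
    | nil => simp
    | cons a p ih =>
      obtain rfl : a = u := by simpa using hhead
      intro w hw
      rcases List.mem_cons.1 hw with rfl | hw
      · exact hu
      · cases p with
        | nil => simp at hw
        | cons b p =>
          rw [List.isChain_cons_cons] at hchain
          exact ih (hadj _ _ hchain.1) rfl hchain.2 w hw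
  rw [← List.toFinset_card_of_nodup hnodup, ← Set.ncard_coe_finset]
  exact Set.ncard_le_ncard fun w hw => hQ w (by simpa using hw)

/-- The outer pieces stay in clusters of at most `r` vertices, and the middle piece visits only
border vertices, none of them twice. -/
theorem IsDividingPath.length_le {r : ℕ} (hr : ∀ p, Set.ncard {v | G.InCluster cl p v} ≤ r)
    (hcl : ∀ d, cl (G.α d) = cl d) {ps pt : K} {fs ft : V} {π : List V}
    (h : G.IsDividingPath cl ps pt fs ft π) : π.length ≤ 2 * r + G.totalBorder cl := by
  classical
  obtain ⟨hfs, -, bs, bt, p₁, p₂, p₃, hbs, hbt, h₁, h₂, h₃, rfl⟩ := h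
  have hadj : ∀ p x y, G.ClusterAdj cl p x y → G.InCluster cl p y := by
    rintro p _ _ ⟨d, hd, -, rfl⟩
    exact ⟨G.α d, rfl, (hcl d).trans hd⟩
  have l₁ := (h₁.length_le hfs (hadj ps)).trans (hr ps)
  have l₃ := (h₃.length_le hbt.1 (hadj pt)).trans (hr pt)
  have l₂ := h₂.length_le (Q := fun v => ∃ p, G.IsBorder cl p v) ⟨ps, hbs⟩ (by
    rintro _ _ ⟨d, hd, ⟨-, rfl⟩ | ⟨rfl, -⟩⟩
    · exact ⟨_, (exit_nextExit.2 hd.1).isBorder⟩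
    · exact ⟨_, hd.1.isBorder⟩)
  have hb : Set.ncard {v | ∃ p, G.IsBorder cl p v} ≤ G.totalBorder cl := by
    rw [totalBorder]
    refine le_trans ?_ (Finset.card_biUnion_le (s := Finset.univ)
      (t := fun p => Finset.univ.filter (G.IsBorder cl p)) |>.trans (Finset.sum_le_sum fun p _ => ?_))
    · rw [← Set.ncard_coe_finset]
      refine Set.ncard_le_ncard ?_
      rintro v ⟨p, hp⟩
      simpa using ⟨p, hp⟩
    · rw [← Set.ncard_coe_finset]
      exact Set.ncard_le_ncard fun v hv => by simpa using hv
  simp only [List.length_append, List.length_tail]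
  omega

/-- At most `c₁ * n / r` clusters with at most `c₂ * √r` border vertices each. The absolute value is
there because no signs are assumed for the constants. -/
theorem IsHolelessRPartition.totalBorder_le {r : ℕ} {c₁ c₂ : ℝ}
    (h : G.IsHolelessRPartition cl r c₁ c₂) (hr : 1 ≤ r) :
    (G.totalBorder cl : ℝ) ≤ |c₁ * c₂| * (Fintype.card V / √(r : ℝ)) := by
  have hr' : (0 : ℝ) < r := by exact_mod_cast hr
  have hs : 0 < √(r : ℝ) := Real.sqrt_pos.2 hr'
  have hn : (0 : ℝ) ≤ Fintype.card V / √(r : ℝ) := by positivity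
  rcases isEmpty_or_nonempty K with hK | ⟨⟨p⟩⟩
  · simp only [totalBorder, Finset.univ_eq_empty, Finset.sum_empty, Nat.cast_zero]
    positivity
  -- As soon as there is a cluster, this product bounds a cardinality and so is nonnegative.
  · have hc : 0 ≤ c₂ * √(r : ℝ) := (Nat.cast_nonneg _).trans (h.card_border p)
    calc (G.totalBorder cl : ℝ) ≤ ∑ _p : K, c₂ * √(r : ℝ) := by
          rw [totalBorder, Nat.cast_sum]
          exact Finset.sum_le_sum fun p _ => h.card_border p
      _ = Fintype.card K * (c₂ * √(r : ℝ)) := by simp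
      _ ≤ c₁ * (Fintype.card V / r) * (c₂ * √(r : ℝ)) :=
          mul_le_mul_of_nonneg_right h.card_clusters hc
      _ = c₁ * c₂ * (Fintype.card V / √(r : ℝ)) := by
          have : (r : ℝ) = √(r : ℝ) * √(r : ℝ) := (Real.mul_self_sqrt hr'.le).symm
          rw [this, Real.sqrt_mul_self hs.le]
          field_simp
      _ ≤ _ := mul_le_mul_of_nonneg_right (le_abs_self _) hn

end counting

end PlaneGraph

/-! ### The bound for a level -/

theorem mainTheorem9 (c₁ c₂ : ℝ) :
    ∃ C : ℝ, ∀ (V D K : Type*) [Fintype V] [Fintype D] [DecidableEq D] [Fintype K]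
      (G : PlaneGraph V D) (cl : D → K) (r : ℕ)
      (_hr : 1 ≤ r)
      (_hdeg : ∀ v, Set.ncard {d | G.vtx d = v} ≤ 3)
      (hP : G.IsHolelessRPartition cl r c₁ c₂)
      (ps pt : K) (ds dt : D) (s t : (D × Fin 4) ⊕ ℕ)
      (_hst : ¬ G.face.SameCycle ds dt)
      (_hs : G.IsCornerInFace cl ps pt ds s)
      (_ht : G.IsCornerInFace cl ps pt dt t)
      (fs ft : V)
      (_hfs : ∃ d, G.face.SameCycle ds d ∧ G.vtx d = fs)
      (_hft : ∃ d, G.face.SameCycle dt d ∧ G.vtx d = ft)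
      (π : List V) (_hπ : G.IsDividingPath cl ps pt fs ft π)
      (T : RecursionTree π ⟨G.contracted cl hP.edge ps pt, s, t⟩ 0 π.length) (l : ℕ),
      (T.levelVertices l : ℝ) ≤ C * ((r : ℝ) + (Fintype.card V : ℝ) / √(r : ℝ)) := by
  refine ⟨37 + 45 * |c₁ * c₂|, ?_⟩
  intro V D K _ _ _ _ G cl r hr hdeg hP ps pt ds dt s t _ _ _ fs ft _ _ π hπ T l
  have hM : (G.contracted cl hP.edge ps pt).IsMap :=
    PlaneGraph.contracted_isMap hP.one_hole (hP.nonempty ps)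
  have h1 := T.levelVertices_le hM l
  have h2 := PlaneGraph.card_contracted_le hdeg hP.card_vertices hP.edge ps pt
  have h3 := hπ.length_le hP.card_vertices hP.edge
  have h4 : (G.contracted cl hP.edge ps pt).numLeaves ≤
      (G.contracted cl hP.edge ps pt).darts.card := by
    rw [← Set.ncard_coe_finset]
    exact Set.ncard_le_ncard (fun x hx => hx.1) (Finset.finite_toSet _)
  -- Leaves are bounded by darts, so the potential is at most `3 * (6 * r + 12 * B) + 1`, and the
  -- splits add `9 * (2 * r + B)`. The sum is `36 * r + 45 * B + 1`, where `1 ≤ r` absorbs the last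
  -- summand.
  have h5 : T.levelVertices l ≤ 37 * r + 45 * G.totalBorder cl := by
    change _ ≤ (G.contracted cl hP.edge ps pt).potential + _ at h1
    unfold PlaneMap.potential at h1
    omega
  have h6 : (T.levelVertices l : ℝ) ≤ 37 * r + 45 * G.totalBorder cl := by exact_mod_cast h5
  have h7 := hP.totalBorder_le hr
  have h8 : (0 : ℝ) ≤ Fintype.card V / √(r : ℝ) := by positivity
  have h9 : 0 ≤ |c₁ * c₂| * (r : ℝ) := by positivity
  nlinarith
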